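/- **Setting.** Let $\mathcal H,\mathcal K$ be complex Hilbert spaces of arbitrary dimension. For bounded self-adjoint operators, $A\ge B$ means that $A-B$ is positive semidefinite; $\operatorname{tr}$ of a positive operator takes values in $[0,\infty]$; and $B\gg A$ means $\ker B\subseteq\ker A$. For $\alpha\in[1/2,1)\cup(1,\infty)$, $B\ge 0$, and $A\ge 0$ with $A\ne 0$ and $\operatorname{tr}A<\infty$, the quantum Rényi divergence is $$D_\alpha(A\|B)=\frac{1}{\alpha-1}\log\left(\frac{1}{\operatorname{tr}A}\operatorname{tr}\left[\left(B^{\frac{1-\alpha}{2\alpha}}AB^{\frac{1-\alpha}{2\alpha}}\right)^{\alpha}\right]\right)\in[-\infty,\infty].$$ Here $\log$ is the natural logarithm, extended by $\log 0=-\infty$ and $\log\infty=\infty$. If $\alpha>1$ and $B$ is not invertible, $B^{\frac{1-\alpha}{2\alpha}}AB^{\frac{1-\alpha}{2\alpha}}$ denotes the unique bounded $X\ge0$ with $\ker B\subseteq\ker X$ and $B^{\frac{\alpha-1}{2\alpha}}XB^{\frac{\alpha-1}{2\alpha}}=A$; if there is no such $X$ (for instance if $B\not\gg A$), the trace is $+\infty$.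 For $\lambda\ge 0$ put $D_{\alpha,\lambda}(A\|B)=D_\alpha(A\|B+\lambda\,\mathrm{Id})$. **Proposition.** Let $\alpha\in[1/2,1)\cup(1,\infty)$. In the following, $\lambda\ge0$ unless stated otherwise, $A,B$ are positive operators on $\mathcal H$ and $C,D$ are positive operators on $\mathcal K$, with $A,C\neq0$ and $\operatorname{tr}A,\operatorname{tr}C<\infty$. 1. *Continuity.* Let $p=\min(\alpha,1)$, let $\operatorname{tr}(A^p)<\infty$ and $B+\lambda\mathrm{Id}\gg A$, and suppose that $\lambda>0$, or $\alpha<1$, or $B$ is invertible. Then $D_{\alpha,\lambda}(A\|B)$ is finite, and $D_{\alpha,\lambda}(A_n\|B_n)\to D_{\alpha,\lambda}(A\|B)$ for all sequences $A_n,B_n\ge0$ with $\operatorname{tr}(|A_n-A|^{p})\to0$ and $\|B_n-B\|\to0$. (In finite dimension both convergences are norm convergence.) 2. *Unitary invariance.* $D_{\alpha,\lambda}(A\|B)=D_{\alpha,\lambda}(UAU^*\|UBU^*)$ for every unitary $U$ on $\mathcal H$. 3. *Normalization.* On the one-dimensional space $\mathbb C$, $D_{\alpha,\lambda}(1\|\tfrac12)=-\log(\tfrac12+\lambda)$.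 4. *Order.* If $A\ge B$, then $D_{\alpha,0}(A\|B)=D_\alpha(A\|B)\ge0$. If $A\le B$, then $D_{\alpha,\lambda}(A\|B)\le0$. 5. *Additivity.* If $B\gg A$ and $D\gg C$, then $$D_{\alpha,\lambda}(A\otimes C\|B\otimes D)\ge D_{\alpha,\sqrt\lambda}(A\|B)+D_{\alpha,\sqrt\lambda}(C\|D).$$ If moreover $B\le\mathrm{Id}$, $D\le\mathrm{Id}$ and $\lambda\le3$, then $$D_{\alpha,\lambda}(A\otimes C\|B\otimes D)\le D_{\alpha,\lambda/3}(A\|B)+D_{\alpha,\lambda/3}(C\|D).$$ 6. *Mean.* Let $g(x)=\exp((\alpha-1)x)$, a bijection $[-\infty,\infty]\to[0,\infty]$. If $B\gg A$, $D\gg C$, $\operatorname{tr}A+\operatorname{tr}C\le1$ and $\operatorname{tr}B+\operatorname{tr}D\le1$, then $$D_{\alpha,\lambda}(A\oplus C\|B\oplus D)=g^{-1}\left(\frac{\operatorname{tr}A}{\operatorname{tr}A+\operatorname{tr}C}\,g(D_{\alpha,\lambda}(A\|B))+\frac{\operatorname{tr}C}{\operatorname{tr}A+\operatorname{tr}C}\,g(D_{\alpha,\lambda}(C\|D))\right).$$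 -/

import Mathlib

open scoped ENNReal TensorProduct InnerProductSpace Topology

noncomputable section

namespace QRenyi

set_option linter.unusedSectionVars false

variable {H : Type*} [NormedAddCommGroup H] [InnerProductSpace ℂ H] [CompleteSpace H]
variable {K : Type*} [NormedAddCommGroup K] [InnerProductSpace ℂ K] [CompleteSpace K]

/-! ### Trace of positive operators -/

/-- The trace `∑ i, ⟪e i, T (e i)⟫ ∈ [0, ∞]` of a positive operator, along an orthonormal basis
of the Hilbert space (by `opTrace_eq_tsum` the value is the same for every basis). -/
def opTrace (T : H →L[ℂ] H) : ℝ≥0∞ :=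
  ∑' i : (exists_hilbertBasis ℂ H).choose,
    ENNReal.ofReal (RCLike.re ⟪(i : H), T (i : H)⟫_ℂ)

lemma parseval_ennreal {ι : Type*} (b : HilbertBasis ι ℂ H) (x : H) :
    ∑' i, ENNReal.ofReal (‖⟪b i, x⟫_ℂ‖ ^ 2) = ENNReal.ofReal (‖x‖ ^ 2) := by
  have h := (b.hasSum_inner_mul_inner x x).mapL (RCLike.reCLM (K := ℂ))
  have e : ∀ i, RCLike.reCLM (K := ℂ) (⟪x, b i⟫_ℂ * ⟪b i, x⟫_ℂ) = ‖⟪b i, x⟫_ℂ‖ ^ 2 := by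
    intro i
    rw [← inner_conj_symm x (b i), RCLike.conj_mul]
    norm_cast
  have e2 : RCLike.reCLM (K := ℂ) ⟪x, x⟫_ℂ = ‖x‖ ^ 2 := by
    simp only [RCLike.reCLM_apply]
    exact (norm_sq_eq_re_inner (𝕜 := ℂ) x).symm
  simp only [e, e2] at h
  rw [← h.tsum_eq, ENNReal.ofReal_tsum_of_nonneg (fun i => by positivity) h.summable]

lemma tsum_basis_eq {ι κ : Type*} (b : HilbertBasis ι ℂ H) (c : HilbertBasis κ ℂ H)
    {T : H →L[ℂ] H} (hT : 0 ≤ T) :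
    ∑' i, ENNReal.ofReal (RCLike.re ⟪b i, T (b i)⟫_ℂ)
      = ∑' j, ENNReal.ofReal (RCLike.re ⟪c j, T (c j)⟫_ℂ) := by
  set S := CFC.sqrt T with hS
  have hSS : S * S = T := CFC.sqrt_mul_sqrt_self T hT
  have hSsa : IsSelfAdjoint S := (CFC.sqrt_nonneg T).isSelfAdjoint
  have hsym : ∀ x y : H, ⟪S x, y⟫_ℂ = ⟪x, S y⟫_ℂ := fun x y => by
    conv_rhs => rw [← ContinuousLinearMap.adjoint_inner_left,
      show ContinuousLinearMap.adjoint S = S from hSsa]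
  have key : ∀ x : H, RCLike.re ⟪x, T x⟫_ℂ = ‖S x‖ ^ 2 := fun x => by
    rw [← hSS, mul_apply_eq_comp, ← hsym, norm_sq_eq_re_inner (𝕜 := ℂ)]
  simp only [key]
  calc ∑' i, ENNReal.ofReal (‖S (b i)‖ ^ 2)
      = ∑' i, ∑' j, ENNReal.ofReal (‖⟪c j, S (b i)⟫_ℂ‖ ^ 2) := by
        simp only [parseval_ennreal c]
    _ = ∑' j, ∑' i, ENNReal.ofReal (‖⟪b i, S (c j)⟫_ℂ‖ ^ 2) := by
        rw [ENNReal.tsum_comm]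
        congr 1; ext j; congr 1; ext i
        rw [← hsym, norm_inner_symm]
    _ = _ := by simp only [parseval_ennreal b]

/-- The trace of a positive operator can be computed in any orthonormal basis. -/
theorem opTrace_eq_tsum {ι : Type*} (b : HilbertBasis ι ℂ H) {T : H →L[ℂ] H} (hT : 0 ≤ T) :
    opTrace T = ∑' i, ENNReal.ofReal (RCLike.re ⟪b i, T (b i)⟫_ℂ) := by
  obtain ⟨c, hc⟩ := (exists_hilbertBasis ℂ H).choose_spec
  rw [← tsum_basis_eq c b hT]
  simp only [hc]
  rfl

/-- Nonzero positive operators of finite trace. -/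
def IsPosTraceClass (A : H →L[ℂ] H) : Prop := 0 ≤ A ∧ A ≠ 0 ∧ opTrace A < ∞

/-- `tr (|T|ᵖ)`, the `p`-th power of the Schatten `p`-(quasi)norm of `T`. -/
def schattenPow (p : ℝ) (T : H →L[ℂ] H) : ℝ≥0∞ := opTrace (CFC.abs T ^ p)

/-- `B` dominates `A`, written `B ≫ A`: the kernel of `B` is contained in that of `A`. -/
def Dominates (B A : H →L[ℂ] H) : Prop := ∀ x, B x = 0 → A x = 0

/-! ### The divergences -/

/-- `X` is the operator `B ^ ((1-α)/(2α)) * A * B ^ ((1-α)/(2α))`. For `α < 1` the exponent is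
positive and this is a formula. For `α > 1` the exponent is negative and `B` need not be
invertible: then `X` is the (unique) positive bounded operator that vanishes on the kernel of `B`
and satisfies `B ^ ((α-1)/(2α)) * X * B ^ ((α-1)/(2α)) = A`; it exists only if `B ≫ A`.
See `isSandwich_iff_of_isUnit` for invertible `B`. -/
def IsSandwich (α : ℝ) (A B X : H →L[ℂ] H) : Prop :=
  if α < 1 then X = B ^ ((1 - α) / (2 * α)) * A * B ^ ((1 - α) / (2 * α))
  else 0 ≤ X ∧ Dominates B X ∧ B ^ ((α - 1) / (2 * α)) * X * B ^ ((α - 1) / (2 * α)) = A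

/-- `tr [(B ^ ((1-α)/(2α)) * A * B ^ ((1-α)/(2α))) ^ α] ∈ [0, ∞]`, with the value `∞` if
the operator inside does not exist as a bounded operator (at most one `X` enters the infimum). -/
def sandwichTrace (α : ℝ) (A B : H →L[ℂ] H) : ℝ≥0∞ :=
  ⨅ (X : H →L[ℂ] H) (_ : IsSandwich α A B X), opTrace (X ^ α)

/-- The order-`α` quantum Rényi divergence `D_α(A‖B)`, with values in `[-∞, ∞]`. -/
def renyiDiv (α : ℝ) (A B : H →L[ℂ] H) : EReal :=
  ((1 / (α - 1) : ℝ) : EReal) * ENNReal.log (sandwichTrace α A B / opTrace A)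

/-- The regularized quantum Rényi divergence `D_{α,λ}(A‖B) = D_α(A‖B + λ Id)`. -/
def regRenyiDiv (α lam : ℝ) (A B : H →L[ℂ] H) : EReal :=
  renyiDiv α A (B + (lam : ℂ) • (1 : H →L[ℂ] H))

/-- For invertible `B` the sandwiched operator is given by the usual formula for every `α`. -/
theorem isSandwich_iff_of_isUnit {α : ℝ} {A B X : H →L[ℂ] H}
    (hA : 0 ≤ A) (hB : 0 ≤ B) (hu : IsUnit B) :
    IsSandwich α A B X ↔ X = B ^ ((1 - α) / (2 * α)) * A * B ^ ((1 - α) / (2 * α)) := by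
  unfold IsSandwich
  split_ifs with h
  · rfl
  have hs : IsStrictlyPositive B := hu.isStrictlyPositive hB
  have e : (1 - α) / (2 * α) = -((α - 1) / (2 * α)) := by ring
  rw [e]
  set s := (α - 1) / (2 * α)
  have h1 : B ^ s * B ^ (-s) = 1 := CFC.rpow_mul_rpow_neg s hs
  have h2 : B ^ (-s) * B ^ s = 1 := CFC.rpow_neg_mul_rpow s hs
  constructor
  · rintro ⟨-, -, hX⟩
    rw [← hX]
    calc X = (B ^ (-s) * B ^ s) * X * (B ^ s * B ^ (-s)) := by rw [h1, h2]; simp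
      _ = _ := by simp only [mul_assoc]
  · intro hX
    refine ⟨?_, ?_, ?_⟩
    · rw [hX]
      have hsa : IsSelfAdjoint (B ^ (-s)) := (CFC.rpow_nonneg (a := B) (y := -s)).isSelfAdjoint
      simpa [hsa.star_eq] using star_left_conjugate_nonneg hA (B ^ (-s))
    · intro x hx
      obtain ⟨u, hu'⟩ := hu
      have : x = 0 := by
        calc x = ((↑u⁻¹ : H →L[ℂ] H) * B) x := by rw [← hu']; simp
          _ = 0 := by rw [mul_apply_eq_comp, hx, map_zero]
      rw [this, map_zero]
    · rw [hX]
      calc B ^ s * (B ^ (-s) * A * B ^ (-s)) * B ^ s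
          = (B ^ s * B ^ (-s)) * A * (B ^ (-s) * B ^ s) := by simp only [mul_assoc]
        _ = A := by rw [h1, h2]; simp

/-- For invertible `B` the trace functional is given by the usual formula for every `α`. -/
theorem sandwichTrace_of_isUnit {α : ℝ} {A B : H →L[ℂ] H}
    (hA : 0 ≤ A) (hB : 0 ≤ B) (hu : IsUnit B) :
    sandwichTrace α A B =
      opTrace ((B ^ ((1 - α) / (2 * α)) * A * B ^ ((1 - α) / (2 * α))) ^ α) := by
  simp only [sandwichTrace, isSandwich_iff_of_isUnit hA hB hu, iInf_iInf_eq_left]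

/-! ### The function `g` of the mean property -/

/-- `g(x) = exp ((α-1) x)` as a map `[-∞, ∞] → [0, ∞]`. -/
def expMean (α : ℝ) (x : EReal) : ℝ≥0∞ := EReal.exp (((α - 1 : ℝ) : EReal) * x)

/-- The inverse `g⁻¹(y) = log y / (α-1)` as a map `[0, ∞] → [-∞, ∞]`. -/
def expMeanInv (α : ℝ) (y : ℝ≥0∞) : EReal := ((1 / (α - 1) : ℝ) : EReal) * ENNReal.log y

theorem expMeanInv_expMean {α : ℝ} (hα : α ≠ 1) (x : EReal) :
    expMeanInv α (expMean α x) = x := by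
  have h : (1 / (α - 1)) * (α - 1) = 1 := by
    have := sub_ne_zero.mpr hα
    field_simp
  rw [expMeanInv, expMean, EReal.log_exp, ← mul_assoc, ← EReal.coe_mul, h, EReal.coe_one, one_mul]

theorem expMean_expMeanInv {α : ℝ} (hα : α ≠ 1) (y : ℝ≥0∞) :
    expMean α (expMeanInv α y) = y := by
  have h : (α - 1) * (1 / (α - 1)) = 1 := by
    have := sub_ne_zero.mpr hα
    field_simp
  rw [expMeanInv, expMean, ← mul_assoc, ← EReal.coe_mul, h, EReal.coe_one, one_mul,
    ENNReal.exp_log]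

/-! ### Direct sums and tensor products of operators -/

/-- The operator `A ⊕ C` on the Hilbert space direct sum `H ⊕ K`. -/
def opSum (A : H →L[ℂ] H) (C : K →L[ℂ] K) : WithLp 2 (H × K) →L[ℂ] WithLp 2 (H × K) :=
  ((WithLp.prodContinuousLinearEquiv 2 ℂ H K).symm : H × K →L[ℂ] WithLp 2 (H × K)) ∘L
    (A.prodMap C) ∘L
    ((WithLp.prodContinuousLinearEquiv 2 ℂ H K) : WithLp 2 (H × K) →L[ℂ] H × K)

variable (H K) in
/-- The Hilbert space tensor product: the completion of the algebraic one. -/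
abbrev HTensor : Type _ := UniformSpace.Completion (H ⊗[ℂ] K)

lemma inner_map_map_adjoint (A A' : H →L[ℂ] H) (C C' : K →L[ℂ] K)
    (hA : ∀ x y, ⟪A x, y⟫_ℂ = ⟪x, A' y⟫_ℂ) (hC : ∀ x y, ⟪C x, y⟫_ℂ = ⟪x, C' y⟫_ℂ)
    (z w : H ⊗[ℂ] K) :
    ⟪TensorProduct.map (A : H →ₗ[ℂ] H) (C : K →ₗ[ℂ] K) z, w⟫_ℂ
      = ⟪z, TensorProduct.map (A' : H →ₗ[ℂ] H) (C' : K →ₗ[ℂ] K) w⟫_ℂ := by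
  induction z using TensorProduct.induction_on with
  | zero => simp
  | add z₁ z₂ h₁ h₂ => rw [map_add, inner_add_left, inner_add_left, h₁, h₂]
  | tmul x y =>
    induction w using TensorProduct.induction_on with
    | zero => simp
    | add w₁ w₂ h₁ h₂ => rw [map_add, inner_add_right, inner_add_right, h₁, h₂]
    | tmul x' y' => simp [hA, hC]

/-- `‖A‖² - A* A = S²` for a self-adjoint `S`, in weak form. -/
lemma exists_defect (A : H →L[ℂ] H) : ∃ S : H →L[ℂ] H, (∀ x y, ⟪S x, y⟫_ℂ = ⟪x, S y⟫_ℂ) ∧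
    (S ∘L S) + (ContinuousLinearMap.adjoint A) ∘L A = ((‖A‖ ^ 2 : ℝ) : ℂ) • (1 : H →L[ℂ] H) := by
  set D : H →L[ℂ] H :=
    ((‖A‖ ^ 2 : ℝ) : ℂ) • (1 : H →L[ℂ] H) - (ContinuousLinearMap.adjoint A) ∘L A with hD
  have hpos : 0 ≤ D := by
    rw [ContinuousLinearMap.nonneg_iff_isPositive, ContinuousLinearMap.isPositive_iff_complex]
    intro x
    have e : ⟪D x, x⟫_ℂ = ((‖A‖ ^ 2 * ‖x‖ ^ 2 - ‖A x‖ ^ 2 : ℝ) : ℂ) := by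
      simp only [hD, sub_apply, smul_apply,
        one_apply_eq_self, ContinuousLinearMap.comp_apply, inner_sub_left,
        inner_smul_left, ContinuousLinearMap.adjoint_inner_left, Complex.conj_ofReal,
        inner_self_eq_norm_sq_to_K]
      push_cast
      rfl
    rw [e]
    refine ⟨by rw [RCLike.re_eq_complex_re, Complex.ofReal_re], ?_⟩
    rw [RCLike.re_eq_complex_re, Complex.ofReal_re]
    have h := A.le_opNorm x
    have h2 : ‖A x‖ ^ 2 ≤ (‖A‖ * ‖x‖) ^ 2 := by gcongr
    rw [mul_pow] at h2
    linarith
  refine ⟨CFC.sqrt D, fun x y => ?_, ?_⟩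
  · have hsa : IsSelfAdjoint (CFC.sqrt D) := (CFC.sqrt_nonneg D).isSelfAdjoint
    conv_rhs => rw [← ContinuousLinearMap.adjoint_inner_left,
      show ContinuousLinearMap.adjoint (CFC.sqrt D) = CFC.sqrt D from hsa]
  · have h : CFC.sqrt D ∘L CFC.sqrt D = D := CFC.sqrt_mul_sqrt_self D hpos
    rw [h, hD]
    simp

lemma norm_map_id_le (A : H →L[ℂ] H) (z : H ⊗[ℂ] K) :
    ‖TensorProduct.map (A : H →ₗ[ℂ] H) ((1 : K →L[ℂ] K) : K →ₗ[ℂ] K) z‖ ≤ ‖A‖ * ‖z‖ := by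
  obtain ⟨S, hS, hSA⟩ := exists_defect A
  have h1 := inner_map_map_adjoint (K := K) A (ContinuousLinearMap.adjoint A) 1 1
    (fun x y => by rw [ContinuousLinearMap.adjoint_inner_right]) (fun x y => rfl) z
    (TensorProduct.map (A : H →ₗ[ℂ] H) ((1 : K →L[ℂ] K) : K →ₗ[ℂ] K) z)
  have h2 := inner_map_map_adjoint (K := K) S S 1 1 hS (fun x y => rfl) z
    (TensorProduct.map (S : H →ₗ[ℂ] H) ((1 : K →L[ℂ] K) : K →ₗ[ℂ] K) z)
  have h3 : TensorProduct.map (S : H →ₗ[ℂ] H) ((1 : K →L[ℂ] K) : K →ₗ[ℂ] K)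
        (TensorProduct.map (S : H →ₗ[ℂ] H) ((1 : K →L[ℂ] K) : K →ₗ[ℂ] K) z)
      + TensorProduct.map (ContinuousLinearMap.adjoint A : H →ₗ[ℂ] H)
          ((1 : K →L[ℂ] K) : K →ₗ[ℂ] K)
          (TensorProduct.map (A : H →ₗ[ℂ] H) ((1 : K →L[ℂ] K) : K →ₗ[ℂ] K) z)
      = ((‖A‖ ^ 2 : ℝ) : ℂ) • z := by
    induction z using TensorProduct.induction_on with
    | zero => simp
    | add z₁ z₂ h₁ h₂ =>
      have := congrArg₂ (· + ·)
        (h₁ (inner_map_map_adjoint (K := K) A (ContinuousLinearMap.adjoint A) 1 1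
          (fun x y => by rw [ContinuousLinearMap.adjoint_inner_right]) (fun x y => rfl) _ _)
          (inner_map_map_adjoint (K := K) S S 1 1 hS (fun x y => rfl) _ _))
        (h₂ (inner_map_map_adjoint (K := K) A (ContinuousLinearMap.adjoint A) 1 1
          (fun x y => by rw [ContinuousLinearMap.adjoint_inner_right]) (fun x y => rfl) _ _)
          (inner_map_map_adjoint (K := K) S S 1 1 hS (fun x y => rfl) _ _))
      simp only [map_add, smul_add] at this ⊢
      rw [← this]; abel
    | tmul x y =>
      have hx := congrArg (fun T : H →L[ℂ] H => T x) hSA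
      simp only [add_apply, ContinuousLinearMap.comp_apply,
        smul_apply, one_apply_eq_self] at hx
      simp only [TensorProduct.map_tmul, ContinuousLinearMap.coe_coe,
        one_apply_eq_self, ← TensorProduct.add_tmul, hx, TensorProduct.smul_tmul']
  have h4 : ‖TensorProduct.map (A : H →ₗ[ℂ] H) ((1 : K →L[ℂ] K) : K →ₗ[ℂ] K) z‖ ^ 2
      + ‖TensorProduct.map (S : H →ₗ[ℂ] H) ((1 : K →L[ℂ] K) : K →ₗ[ℂ] K) z‖ ^ 2
      = ‖A‖ ^ 2 * ‖z‖ ^ 2 := by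
    have h5 : (((‖TensorProduct.map (A : H →ₗ[ℂ] H) ((1 : K →L[ℂ] K) : K →ₗ[ℂ] K) z‖ ^ 2
      + ‖TensorProduct.map (S : H →ₗ[ℂ] H) ((1 : K →L[ℂ] K) : K →ₗ[ℂ] K) z‖ ^ 2 : ℝ)) : ℂ)
      = ((‖A‖ ^ 2 * ‖z‖ ^ 2 : ℝ) : ℂ) := by
      have h6 := congrArg (fun w => ⟪z, w⟫_ℂ) h3
      have hq : ∀ w : H ⊗[ℂ] K, ⟪w, w⟫_ℂ = (‖w‖ : ℂ) ^ 2 :=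
        fun w => inner_self_eq_norm_sq_to_K w
      have hs : ⟪z, ((‖A‖ ^ 2 : ℝ) : ℂ) • z⟫_ℂ = ((‖A‖ ^ 2 : ℝ) : ℂ) * ⟪z, z⟫_ℂ :=
        inner_smul_right (𝕜 := ℂ) (E := H ⊗[ℂ] K) z z _
      simp only [inner_add_right] at h6
      rw [← h1, ← h2, hs, hq, hq, hq] at h6
      push_cast at h6 ⊢
      rw [add_comm]
      exact h6
    exact_mod_cast h5
  refine le_of_sq_le_sq ?_ (by positivity)
  rw [mul_pow, ← h4]
  exact le_add_of_nonneg_right (by positivity)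

lemma norm_map_le (A : H →L[ℂ] H) (C : K →L[ℂ] K) (z : H ⊗[ℂ] K) :
    ‖TensorProduct.map (A : H →ₗ[ℂ] H) (C : K →ₗ[ℂ] K) z‖ ≤ ‖A‖ * ‖C‖ * ‖z‖ := by
  have e : TensorProduct.map (A : H →ₗ[ℂ] H) (C : K →ₗ[ℂ] K) z
      = TensorProduct.map (A : H →ₗ[ℂ] H) ((1 : K →L[ℂ] K) : K →ₗ[ℂ] K)
        (TensorProduct.comm ℂ K H (TensorProduct.map (C : K →ₗ[ℂ] K)
          ((1 : H →L[ℂ] H) : H →ₗ[ℂ] H) (TensorProduct.comm ℂ H K z))) := by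
    induction z using TensorProduct.induction_on with
    | zero => simp
    | add z₁ z₂ h₁ h₂ => simp only [map_add, h₁, h₂]
    | tmul x y => simp
  rw [e, mul_assoc]
  refine (norm_map_id_le A _).trans ?_
  rw [TensorProduct.norm_comm]
  gcongr
  refine (norm_map_id_le C _).trans ?_
  rw [TensorProduct.norm_comm]

/-- The bounded operator `x ⊗ y ↦ A x ⊗ C y` on the algebraic tensor product. -/
def algTensor (A : H →L[ℂ] H) (C : K →L[ℂ] K) : H ⊗[ℂ] K →L[ℂ] H ⊗[ℂ] K :=
  (TensorProduct.map (A : H →ₗ[ℂ] H) (C : K →ₗ[ℂ] K)).mkContinuous (‖A‖ * ‖C‖) (norm_map_le A C)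

/-- The operator `A ⊗ C` on the Hilbert space tensor product of `H` and `K`. -/
def opTensor (A : H →L[ℂ] H) (C : K →L[ℂ] K) : HTensor H K →L[ℂ] HTensor H K :=
  ((UniformSpace.Completion.toComplL : H ⊗[ℂ] K →L[ℂ] HTensor H K) ∘L algTensor A C).extend
    (UniformSpace.Completion.toComplL : H ⊗[ℂ] K →L[ℂ] HTensor H K)

theorem opTensor_coe_tmul (A : H →L[ℂ] H) (C : K →L[ℂ] K) (x : H) (y : K) :
    opTensor A C ((x ⊗ₜ[ℂ] y : H ⊗[ℂ] K) : HTensor H K)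
      = ((A x ⊗ₜ[ℂ] C y : H ⊗[ℂ] K) : HTensor H K) := by
  have h := ContinuousLinearMap.extend_eq
    ((UniformSpace.Completion.toComplL : H ⊗[ℂ] K →L[ℂ] HTensor H K) ∘L algTensor A C)
    (e := (UniformSpace.Completion.toComplL : H ⊗[ℂ] K →L[ℂ] HTensor H K))
    UniformSpace.Completion.denseRange_coe
    (UniformSpace.Completion.isUniformInducing_coe _) (x ⊗ₜ[ℂ] y)
  simpa [algTensor, opTensor] using h

end QRenyi

end

/-! Everything reduces to the functional Q(A, B) = `sandwichTrace α A B`, since D_α(A‖B) = log (Q(A,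
B) / tr A) / (α - 1). Q is unitarily invariant, additive under ⊕ and, under the domination
hypotheses, multiplicative under ⊗. It satisfies Q(A, A) = tr A. It is monotone in B for α < 1 and
antitone for α > 1; as 1/(α - 1) changes sign at the same point, D_α is antitone in B throughout
(`renyiDiv_anti`). The order property compares B with A and uses D_α(A‖A) = 0. The mean property is
additivity of Q read through g. The two additivity inequalities combine exact additivity for B + μ
and D + μ (`renyiDiv_opTensor`) with an operator inequality between (B + μ) ⊗ (D + μ) and B ⊗ D + λ.

Diagonalization is replaced by two tools. A norm-continuous semigroup of positive operators consists
of the powers of its value at 1 (`eq_rpow_of_semigroup`); this computes powers of conjugates, direct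
sums and tensor products. Douglas factorization with the Löwner–Heinz inequality turns 0 ≤ A ≤ B
into A ^ r = C B ^ r with a contraction C, for 0 < r ≤ 1/2. They yield tr (W* W) ^ r = tr (W W*) ^
r, monotonicity of tr X ^ r for every r > 0, and subadditivity of tr X ^ a for a < 1.

Continuity follows from explicit two-sided estimates for tr (√A M √A) ^ p with p ≤ 1
(`tendsto_opTrace_rpow_sqrt_conj`). For α < 1 take p = α and M = B ^ ((1-α)/α). For α > 1 one factor
of the sandwich is split off from its α-th power, which leaves p = 1 and a bounded M depending
continuously on A and B (`opTrace_rpow_conj_eq`). -/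

open scoped ENNReal TensorProduct InnerProductSpace Topology

noncomputable section

namespace QRenyi

set_option linter.unusedSectionVars false

/-! ### Traces, kernels of powers, and uniqueness in compressions. -/

section Trace

variable {H : Type*} [NormedAddCommGroup H] [InnerProductSpace ℂ H] [CompleteSpace H]
variable {K : Type*} [NormedAddCommGroup K] [InnerProductSpace ℂ K] [CompleteSpace K]

open ContinuousLinearMap in
lemma inner_apply_of_isSelfAdjoint {T : H →L[ℂ] H} (hT : IsSelfAdjoint T) (x y : H) :
    ⟪T x, y⟫_ℂ = ⟪x, T y⟫_ℂ := by
  conv_rhs => rw [← adjoint_inner_left, show adjoint T = T from hT]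

lemma re_inner_nonneg {T : H →L[ℂ] H} (hT : 0 ≤ T) (x : H) : 0 ≤ RCLike.re ⟪x, T x⟫_ℂ :=
  ((ContinuousLinearMap.nonneg_iff_isPositive T).1 hT).re_inner_nonneg_right x

lemma re_inner_le {S T : H →L[ℂ] H} (h : S ≤ T) (x : H) :
    RCLike.re ⟪x, S x⟫_ℂ ≤ RCLike.re ⟪x, T x⟫_ℂ := by
  have := re_inner_nonneg (sub_nonneg.2 h) x
  rw [sub_apply, inner_sub_right, map_sub] at this
  linarith

lemma le_of_re_inner_le {S T : H →L[ℂ] H} (hS : IsSelfAdjoint S) (hT : IsSelfAdjoint T)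
    (h : ∀ x, RCLike.re ⟪x, S x⟫_ℂ ≤ RCLike.re ⟪x, T x⟫_ℂ) : S ≤ T := by
  rw [← sub_nonneg, ContinuousLinearMap.nonneg_iff_isPositive, ContinuousLinearMap.isPositive_def']
  refine ⟨hT.sub hS, fun x => ?_⟩
  rw [ContinuousLinearMap.reApplyInnerSelf_apply, inner_re_symm, sub_apply, inner_sub_right,
    map_sub]
  linarith [h x]

lemma re_inner_star_mul_self (W : H →L[ℂ] H) (x : H) :
    RCLike.re ⟪x, (star W * W) x⟫_ℂ = ‖W x‖ ^ 2 := by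
  rw [mul_apply_eq_comp, ContinuousLinearMap.star_eq_adjoint,
    ContinuousLinearMap.adjoint_inner_right, ← norm_sq_eq_re_inner (𝕜 := ℂ)]

lemma re_inner_mul_self {S : H →L[ℂ] H} (hS : IsSelfAdjoint S) (x : H) :
    RCLike.re ⟪x, (S * S) x⟫_ℂ = ‖S x‖ ^ 2 := by
  simpa [hS.star_eq] using re_inner_star_mul_self S x

lemma re_inner_eq_norm_sqrt {T : H →L[ℂ] H} (hT : 0 ≤ T) (x : H) :
    RCLike.re ⟪x, T x⟫_ℂ = ‖CFC.sqrt T x‖ ^ 2 := by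
  rw [← re_inner_mul_self (CFC.sqrt_nonneg T).isSelfAdjoint, CFC.sqrt_mul_sqrt_self T hT]

lemma conj_nonneg {A S : H →L[ℂ] H} (hA : 0 ≤ A) (hS : IsSelfAdjoint S) : 0 ≤ S * A * S := by
  simpa [hS.star_eq] using star_left_conjugate_nonneg hA S

lemma conj_le_conj {A B S : H →L[ℂ] H} (h : A ≤ B) (hS : IsSelfAdjoint S) :
    S * A * S ≤ S * B * S := by
  simpa [hS.star_eq] using star_left_conjugate_le_conjugate h S

lemma rpow_isSelfAdjoint (B : H →L[ℂ] H) (r : ℝ) : IsSelfAdjoint (B ^ r) :=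
  (CFC.rpow_nonneg (a := B) (y := r)).isSelfAdjoint

lemma sqrt_isSelfAdjoint (B : H →L[ℂ] H) : IsSelfAdjoint (CFC.sqrt B) :=
  (CFC.sqrt_nonneg B).isSelfAdjoint

/-! ### Traces -/

lemma opTrace_mono {S T : H →L[ℂ] H} (h : S ≤ T) : opTrace S ≤ opTrace T :=
  ENNReal.tsum_le_tsum fun _ => ENNReal.ofReal_le_ofReal (re_inner_le h _)

lemma opTrace_add {S T : H →L[ℂ] H} (hS : 0 ≤ S) (hT : 0 ≤ T) :
    opTrace (S + T) = opTrace S + opTrace T := by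
  unfold opTrace
  rw [← ENNReal.tsum_add]
  congr 1; ext i
  rw [← ENNReal.ofReal_add (re_inner_nonneg hS _) (re_inner_nonneg hT _), add_apply,
    inner_add_right, map_add]

lemma opTrace_smul {c : ℝ} (hc : 0 ≤ c) (T : H →L[ℂ] H) :
    opTrace ((c : ℂ) • T) = ENNReal.ofReal c * opTrace T := by
  unfold opTrace
  rw [← ENNReal.tsum_mul_left]
  congr 1; ext i
  rw [← ENNReal.ofReal_mul hc, smul_apply, inner_smul_right, RCLike.re_eq_complex_re,
    Complex.re_ofReal_mul]

-- Both sides are the double sum of |⟪c j, W (b i)⟫|² over orthonormal bases. Two different spaces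
-- are allowed so that isometries into a direct sum are covered.
open ContinuousLinearMap in
lemma opTrace_adjoint_comp_self (W : H →L[ℂ] K) :
    opTrace (adjoint W ∘L W) = opTrace (W ∘L adjoint W) := by
  have hb := (exists_hilbertBasis ℂ H).choose_spec
  have hc := (exists_hilbertBasis ℂ K).choose_spec
  obtain ⟨b, hb⟩ := hb
  obtain ⟨c, hc⟩ := hc
  have e1 : ∀ x : H, RCLike.re ⟪x, (adjoint W ∘L W) x⟫_ℂ = ‖W x‖ ^ 2 := fun x => by
    rw [ContinuousLinearMap.comp_apply, adjoint_inner_right, ← norm_sq_eq_re_inner (𝕜 := ℂ)]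
  have e2 : ∀ x : K, RCLike.re ⟪x, (W ∘L adjoint W) x⟫_ℂ = ‖adjoint W x‖ ^ 2 := fun x => by
    rw [ContinuousLinearMap.comp_apply, ← adjoint_inner_left, ← norm_sq_eq_re_inner (𝕜 := ℂ)]
  unfold opTrace
  have hb' : ∀ i : (exists_hilbertBasis ℂ H).choose, (i : H) = b i := fun i => by rw [hb]
  have hc' : ∀ i : (exists_hilbertBasis ℂ K).choose, (i : K) = c i := fun i => by rw [hc]
  simp only [e1, e2, hb', hc']
  calc ∑' i, ENNReal.ofReal (‖W (b i)‖ ^ 2)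
      = ∑' i, ∑' j, ENNReal.ofReal (‖⟪c j, W (b i)⟫_ℂ‖ ^ 2) := by
        simp only [parseval_ennreal c]
    _ = ∑' j, ∑' i, ENNReal.ofReal (‖⟪b i, adjoint W (c j)⟫_ℂ‖ ^ 2) := by
        rw [ENNReal.tsum_comm]
        congr 1; ext j; congr 1; ext i
        rw [adjoint_inner_right, norm_inner_symm]
    _ = _ := by simp only [parseval_ennreal b]

lemma opTrace_star_mul_self (W : H →L[ℂ] H) : opTrace (star W * W) = opTrace (W * star W) :=
  opTrace_adjoint_comp_self W

/-- Parseval for √T x, followed by Cauchy–Schwarz in each term ⟪√T (b i), x⟫. -/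
lemma ofReal_re_inner_le_opTrace {T : H →L[ℂ] H} (hT : 0 ≤ T) (x : H) :
    ENNReal.ofReal (RCLike.re ⟪x, T x⟫_ℂ) ≤ opTrace T * ENNReal.ofReal (‖x‖ ^ 2) := by
  obtain ⟨b, hb⟩ := (exists_hilbertBasis ℂ H).choose_spec
  rw [opTrace_eq_tsum b hT, ← ENNReal.tsum_mul_right]
  simp only [re_inner_eq_norm_sqrt hT]
  rw [← parseval_ennreal b]
  refine ENNReal.tsum_le_tsum fun i => ?_
  rw [← ENNReal.ofReal_mul (by positivity), ← inner_apply_of_isSelfAdjoint (sqrt_isSelfAdjoint T),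
    ← mul_pow]
  gcongr
  exact norm_inner_le_norm _ _

lemma ofReal_norm_le_opTrace {T : H →L[ℂ] H} (hT : 0 ≤ T) :
    ENNReal.ofReal ‖T‖ ≤ opTrace T := by
  by_cases h : opTrace T = ∞
  · rw [h]; exact le_top
  refine ENNReal.ofReal_le_of_le_toReal ?_
  have hs : ‖CFC.sqrt T‖ ≤ √(opTrace T).toReal := by
    refine ContinuousLinearMap.opNorm_le_bound _ (by positivity) fun x => ?_
    have h1 := ofReal_re_inner_le_opTrace hT x
    rw [re_inner_eq_norm_sqrt hT, ← ENNReal.ofReal_toReal h,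
      ← ENNReal.ofReal_mul ENNReal.toReal_nonneg,
      ENNReal.ofReal_le_ofReal_iff (by positivity)] at h1
    refine le_of_sq_le_sq ?_ (by positivity)
    rwa [mul_pow, Real.sq_sqrt ENNReal.toReal_nonneg]
  calc ‖T‖ = ‖CFC.sqrt T * CFC.sqrt T‖ := by rw [CFC.sqrt_mul_sqrt_self T hT]
    _ ≤ ‖CFC.sqrt T‖ * ‖CFC.sqrt T‖ := norm_mul_le _ _
    _ ≤ √(opTrace T).toReal * √(opTrace T).toReal := by gcongr
    _ = _ := Real.mul_self_sqrt ENNReal.toReal_nonneg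

lemma eq_zero_of_opTrace_eq_zero {T : H →L[ℂ] H} (hT : 0 ≤ T) (h : opTrace T = 0) : T = 0 := by
  have := ofReal_norm_le_opTrace hT
  rw [h, nonpos_iff_eq_zero, ENNReal.ofReal_eq_zero] at this
  exact norm_le_zero_iff.1 this

lemma le_norm_smul_one {M : H →L[ℂ] H} (hM : IsSelfAdjoint M) :
    M ≤ ((‖M‖ : ℝ) : ℂ) • (1 : H →L[ℂ] H) := by
  have := hM.le_algebraMap_norm_self
  rwa [IsScalarTower.algebraMap_apply ℝ ℂ (H →L[ℂ] H), Algebra.algebraMap_eq_smul_one] at this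

lemma smul_isSelfAdjoint {T : H →L[ℂ] H} (hT : IsSelfAdjoint T) (c : ℝ) :
    IsSelfAdjoint ((c : ℂ) • T) := by
  rw [isSelfAdjoint_iff, star_smul, hT.star_eq]; simp

lemma opTrace_sandwich_le {A M : H →L[ℂ] H} (hA : 0 ≤ A) {c : ℝ} (hc : 0 ≤ c)
    (h : M ≤ (c : ℂ) • (1 : H →L[ℂ] H)) :
    opTrace (CFC.sqrt A * M * CFC.sqrt A) ≤ ENNReal.ofReal c * opTrace A := by
  rw [← opTrace_smul hc]
  refine opTrace_mono ((conj_le_conj h (sqrt_isSelfAdjoint A)).trans_eq ?_)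
  rw [mul_smul_comm, smul_mul_assoc, mul_one, CFC.sqrt_mul_sqrt_self A hA]

/-- The trace does not increase under conjugation with a contraction. -/
lemma opTrace_star_conj_le {A C : H →L[ℂ] H} (hA : 0 ≤ A) (hC : ‖C‖ ≤ 1) :
    opTrace (star C * A * C) ≤ opTrace A := by
  have h := opTrace_star_mul_self (CFC.sqrt A * C)
  rw [star_mul, (sqrt_isSelfAdjoint A).star_eq] at h
  have h2 : star C * A * C = star C * CFC.sqrt A * (CFC.sqrt A * C) := by
    conv_lhs => rw [← CFC.sqrt_mul_sqrt_self A hA]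
    simp only [mul_assoc]
  rw [h2, h, show CFC.sqrt A * C * (star C * CFC.sqrt A)
    = CFC.sqrt A * (C * star C) * CFC.sqrt A by simp only [mul_assoc]]
  have hn : ‖C * star C‖ ≤ 1 := by
    rw [CStarRing.norm_self_mul_star]; exact mul_le_one₀ hC (norm_nonneg _) hC
  have h3 : C * star C ≤ ((1 : ℝ) : ℂ) • (1 : H →L[ℂ] H) := by
    refine (le_norm_smul_one (IsSelfAdjoint.mul_star_self C)).trans
      (le_of_re_inner_le (smul_isSelfAdjoint (.one _) _) (smul_isSelfAdjoint (.one _) _) fun x => ?_)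
    simp only [smul_apply, one_apply_eq_self, inner_smul_right, RCLike.re_eq_complex_re,
      Complex.re_ofReal_mul]
    have := inner_self_nonneg (𝕜 := ℂ) (x := x)
    rw [RCLike.re_eq_complex_re] at this
    gcongr
  simpa using opTrace_sandwich_le hA zero_le_one h3

/-! ### Powers -/

/-- Positive exponents make additivity hold without invertibility. Positivity of B is not needed
either, because the functional calculus gives 0 otherwise. -/
lemma rpow_add_of_pos (B : H →L[ℂ] H) {r s : ℝ} (hr : 0 < r) (hs : 0 < s) :
    B ^ (r + s) = B ^ r * B ^ s := by
  lift r to NNReal using hr.le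
  lift s to NNReal using hs.le
  rw [NNReal.coe_pos] at hr hs
  rw [← NNReal.coe_add, ← CFC.nnrpow_eq_rpow hr, ← CFC.nnrpow_eq_rpow hs,
    ← CFC.nnrpow_eq_rpow (add_pos hr hs), CFC.nnrpow_add hr hs]

lemma rpow_half_mul_self (B : H →L[ℂ] H) {r : ℝ} (hr : 0 < r) :
    B ^ (r / 2) * B ^ (r / 2) = B ^ r := by
  rw [← rpow_add_of_pos B (by positivity) (by positivity), add_halves]

lemma sqrt_rpow_of_pos (B : H →L[ℂ] H) {r : ℝ} (hr : 0 < r) : CFC.sqrt (B ^ r) = B ^ (r / 2) :=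
  CFC.sqrt_unique (rpow_half_mul_self B hr) CFC.rpow_nonneg

/-- ‖B ^ (q/2) x‖² = ⟪x, B ^ q x⟫ passes the kernel to half the exponent, and multiplication by a
further power passes it to larger exponents. Halving often enough gets below any positive target. -/
lemma rpow_apply_eq_zero_iff {B : H →L[ℂ] H} (hB : 0 ≤ B) {r : ℝ} (hr : 0 < r) (x : H) :
    (B ^ r) x = 0 ↔ B x = 0 := by
  have half : ∀ {q : ℝ}, 0 < q → (B ^ q) x = 0 → (B ^ (q / 2)) x = 0 := fun {q} hq h => by
    have h1 := re_inner_mul_self (rpow_isSelfAdjoint B (q / 2)) x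
    rw [rpow_half_mul_self B hq, h, inner_zero_right, map_zero] at h1
    exact norm_eq_zero.1 (pow_eq_zero_iff two_ne_zero |>.1 h1.symm)
  have up : ∀ {q p : ℝ}, 0 < q → q ≤ p → (B ^ q) x = 0 → (B ^ p) x = 0 := fun {q p} hq hqp h => by
    rcases hqp.eq_or_lt with rfl | hlt
    · exact h
    · rw [show p = (p - q) + q by ring, rpow_add_of_pos B (by linarith) hq, mul_apply_eq_comp, h,
        map_zero]
  have all : ∀ {q p : ℝ}, 0 < q → 0 < p → (B ^ q) x = 0 → (B ^ p) x = 0 := fun {q p} hq hp h => by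
    have hd : ∀ n : ℕ, (B ^ (q / 2 ^ n)) x = 0 := fun n => by
      induction n with
      | zero => simpa using h
      | succ n ih =>
        have := half (by positivity) ih
        rwa [div_div, ← pow_succ] at this
    obtain ⟨n, hn⟩ := pow_unbounded_of_one_lt (q / p) (one_lt_two (α := ℝ))
    refine up (by positivity) ?_ (hd n)
    rw [div_lt_iff₀ hp] at hn
    rw [div_le_iff₀ (by positivity)]
    linarith
  rw [← CFC.rpow_one B hB, CFC.rpow_rpow_of_exponent_nonneg B 1 r zero_le_one hr.le hB, one_mul]
  exact ⟨all hr one_pos, all one_pos hr⟩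

lemma rpow_mul_eq_zero {B T : H →L[ℂ] H} (hB : 0 ≤ B) {r q : ℝ} (hr : 0 < r) (hq : 0 < q)
    (h : B ^ r * T = 0) : B ^ q * T = 0 := by
  ext x
  have := DFunLike.congr_fun h x
  rw [mul_apply_eq_comp, zero_apply, rpow_apply_eq_zero_iff hB hr] at this
  rw [mul_apply_eq_comp, zero_apply, rpow_apply_eq_zero_iff hB hq, this]

lemma eq_zero_of_mul_self {D : H →L[ℂ] H} (hD : IsSelfAdjoint D) (h : D * D = 0) : D = 0 := by
  rw [← CStarRing.star_mul_self_eq_zero_iff, hD.star_eq, h]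

/-- An operator with `ker B` in its kernel is determined by its compression with `B`. -/
lemma eq_of_conj_eq {B X Y : H →L[ℂ] H} (hB : IsSelfAdjoint B) (hX : IsSelfAdjoint X)
    (hY : IsSelfAdjoint Y) (hdX : Dominates B X) (hdY : Dominates B Y)
    (h : B * X * B = B * Y * B) : X = Y := by
  rw [← sub_eq_zero]
  set D := X - Y with hDdef
  have hD : IsSelfAdjoint D := hX.sub hY
  have hker : ∀ x, B x = 0 → D x = 0 := fun x hx => by
    rw [hDdef, sub_apply, hdX x hx, hdY x hx, sub_zero]
  have h0 : B * (D * B) = 0 := by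
    rw [hDdef, sub_mul, mul_sub, ← mul_assoc, ← mul_assoc, h, sub_self]
  -- The range of DB lies in ker B, hence in ker D. The same argument applied to BD = 0 finishes the
  -- proof.
  have h1 : D * (D * B) = 0 := by
    ext x
    exact hker _ (DFunLike.congr_fun h0 x)
  have h2 : D * B = 0 := by
    rw [← CStarRing.star_mul_self_eq_zero_iff, star_mul, hD.star_eq, mul_assoc, h1, mul_zero]
  have h3 : B * D = 0 := by
    have := congrArg star h2
    rwa [star_mul, hD.star_eq, hB.star_eq, star_zero] at this
  refine eq_zero_of_mul_self hD ?_
  ext x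
  exact hker _ (DFunLike.congr_fun h3 x)

end Trace

/-! ### Contractive factorizations, power semigroups, and trace inequalities for powers. -/

section Powers

variable {H : Type*} [NormedAddCommGroup H] [InnerProductSpace ℂ H] [CompleteSpace H]
variable {K : Type*} [NormedAddCommGroup K] [InnerProductSpace ℂ K] [CompleteSpace K]

/-- Douglas' factorization lemma. -/
lemma exists_contraction_factor {P Q : H →L[ℂ] H} (h : ∀ x, ‖P x‖ ≤ ‖Q x‖) :
    ∃ C : H →L[ℂ] H, ‖C‖ ≤ 1 ∧ C * Q = P ∧ ∀ x, (∀ y, ⟪Q y, x⟫_ℂ = 0) → C x = 0 := by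
  set R := LinearMap.range (Q : H →ₗ[ℂ] H) with hR
  -- `g` is a linear section of Q over its range, with no continuity claimed. Still P ∘ g is
  -- bounded, since ‖P (g y)‖ ≤ ‖Q (g y)‖ = ‖y‖. It extends to the closure of the range and is set
  -- to 0 on the orthogonal complement.
  obtain ⟨g, hg⟩ := (Q : H →ₗ[ℂ] H).rangeRestrict.exists_rightInverse_of_surjective
    (LinearMap.range_rangeRestrict _)
  have hQg : ∀ y : R, Q (g y) = y := fun y => congrArg Subtype.val (LinearMap.congr_fun hg y)
  let f : R →L[ℂ] H := ((P : H →ₗ[ℂ] H) ∘ₗ g).mkContinuous 1 fun y => by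
    rw [one_mul]
    exact (h (g y)).trans_eq (by rw [hQg]; rfl)
  have hf : ∀ y, f y = P (g y) := fun y => rfl
  have hfn : ∀ y, ‖f y‖ ≤ ‖y‖ := fun y => (h (g y)).trans_eq (by rw [hQg]; rfl)
  let ι : R →L[ℂ] R.topologicalClosure :=
    (Submodule.inclusion R.le_topologicalClosure).mkContinuous 1 fun y => by
      rw [one_mul]; exact le_rfl
  have hι : ∀ y, ((ι y : R.topologicalClosure) : H) = y := fun y => rfl
  have hdense : DenseRange ι := by
    intro y
    rw [mem_closure_iff_seq_limit]
    obtain ⟨u, hu, hlim⟩ := mem_closure_iff_seq_limit.1 (show (y : H) ∈ closure (R : Set H) from y.2)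
    exact ⟨fun n => ι ⟨u n, hu n⟩, fun n => ⟨_, rfl⟩, tendsto_subtype_rng.2 hlim⟩
  have hiso : Isometry ι := AddMonoidHomClass.isometry_of_norm ι fun y => rfl
  let F : R.topologicalClosure →L[ℂ] H := f.extend ι
  have hF : ∀ y, F (ι y) = f y := fun y =>
    ContinuousLinearMap.extend_eq f hdense hiso.isUniformInducing y
  have hFn : ∀ y, ‖F y‖ ≤ ‖y‖ := fun y => by
    refine hdense.induction_on y (isClosed_le (by fun_prop) (by fun_prop)) fun z => ?_
    rw [hF]
    exact hfn z
  have : CompleteSpace R.topologicalClosure :=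
    R.isClosed_topologicalClosure.completeSpace_coe
  refine ⟨F ∘L R.topologicalClosure.orthogonalProjectionOnto, ?_, ?_, ?_⟩
  · refine ContinuousLinearMap.opNorm_le_bound _ zero_le_one fun x => ?_
    rw [one_mul]
    exact (hFn _).trans (R.topologicalClosure.norm_orthogonalProjectionOnto_apply_le x)
  · ext x
    have hx : Q x ∈ R := ⟨x, rfl⟩
    have e : R.topologicalClosure.orthogonalProjectionOnto (Q x) = ι ⟨Q x, hx⟩ :=
      Submodule.orthogonalProjectionOnto_mem_subspace_eq_self (ι ⟨Q x, hx⟩)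
    rw [mul_apply_eq_comp, ContinuousLinearMap.comp_apply, e, hF, hf, ← sub_eq_zero, ← map_sub]
    refine norm_le_zero_iff.1 ((h _).trans_eq ?_)
    rw [map_sub, hQg, sub_self, norm_zero]
  · intro x hx
    have hmem : x ∈ R.topologicalClosureᗮ := by
      rw [Submodule.orthogonal_closure, Submodule.mem_orthogonal]
      rintro _ ⟨y, rfl⟩
      exact hx y
    rw [ContinuousLinearMap.comp_apply,
      Submodule.orthogonalProjectionOnto_apply_of_mem_orthogonal hmem, map_zero]

lemma exists_contraction_factor_of_isSelfAdjoint {P Q : H →L[ℂ] H} (hQ : IsSelfAdjoint Q)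
    (h : ∀ x, ‖P x‖ ≤ ‖Q x‖) :
    ∃ C : H →L[ℂ] H, ‖C‖ ≤ 1 ∧ C * Q = P ∧ Dominates Q C := by
  obtain ⟨C, h1, h2, h3⟩ := exists_contraction_factor h
  refine ⟨C, h1, h2, fun x hx => h3 x fun y => ?_⟩
  rw [inner_apply_of_isSelfAdjoint hQ, hx, inner_zero_right]

lemma norm_apply_le_of_mul_self_le {P Q : H →L[ℂ] H} (hP : IsSelfAdjoint P) (hQ : IsSelfAdjoint Q)
    (h : P * P ≤ Q * Q) (x : H) : ‖P x‖ ≤ ‖Q x‖ := by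
  have := re_inner_le h x
  rw [re_inner_mul_self hP, re_inner_mul_self hQ] at this
  exact le_of_sq_le_sq this (norm_nonneg _)

/-- The condition 2r ≤ 1 lets Löwner–Heinz give A ^ (2r) ≤ B ^ (2r), which is the norm inequality
required for factorization. -/
lemma exists_contraction_rpow {A B : H →L[ℂ] H} (hB : 0 ≤ B) (h : A ≤ B) {r : ℝ}
    (hr : 0 < r) (hr1 : 2 * r ≤ 1) :
    ∃ C : H →L[ℂ] H, ‖C‖ ≤ 1 ∧ C * B ^ r = A ^ r ∧ Dominates B C := by
  have hAB : A ^ r * A ^ r ≤ B ^ r * B ^ r := by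
    rw [← rpow_add_of_pos A hr hr, ← rpow_add_of_pos B hr hr]
    exact CFC.rpow_le_rpow ⟨by linarith, by linarith⟩ h
  obtain ⟨C, h1, h2, h3⟩ := exists_contraction_factor_of_isSelfAdjoint (rpow_isSelfAdjoint B r)
    (norm_apply_le_of_mul_self_le (rpow_isSelfAdjoint A r) (rpow_isSelfAdjoint B r) hAB)
  exact ⟨C, h1, h2, fun x hx => h3 x ((rpow_apply_eq_zero_iff hB hr x).2 hx)⟩

/-! ### Power semigroups -/

/-- Joint continuity of (r, x) ↦ x ^ r at r > 0 is uniform over the compact spectrum. Exponent 0 is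
excluded because 0 ^ r jumps there. -/
lemma continuousOn_rpow_exponent (a : H →L[ℂ] H) :
    ContinuousOn (fun r : ℝ => a ^ r) (Set.Ioi 0) := by
  open scoped ContinuousFunctionalCalculus in
  have hc : CompactSpace (spectrum NNReal a) := inferInstance
  intro r hr
  refine ContinuousAt.continuousWithinAt ?_
  refine continuousAt_cfc_fun (f := fun (r : ℝ) (x : NNReal) => x ^ r) ?_ ?_
  · rw [tendstoUniformlyOn_iff_tendstoUniformly_comp_coe]
    refine ContinuousOn.tendstoUniformly (f := fun (r : ℝ) (x : spectrum NNReal a) => (x : NNReal) ^ r)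
      (Ioi_mem_nhds hr) fun p hp => ?_
    exact (NNReal.continuousAt_rpow (x := (p.2 : NNReal)) (y := p.1) (Or.inr hp.1)).comp_of_eq
      (f := fun p : ℝ × spectrum NNReal a => ((p.2 : NNReal), p.1)) (by fun_prop) rfl
      |>.continuousWithinAt
  · filter_upwards [Ioi_mem_nhds hr] with q hq
    exact (NNReal.continuous_rpow_const (le_of_lt hq)).continuousOn

/-- A norm-continuous semigroup of positive operators consists of powers. -/
lemma eq_rpow_of_semigroup {g : ℝ → H →L[ℂ] H} (hpos : ∀ r, 0 < r → 0 ≤ g r)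
    (hadd : ∀ r s, 0 < r → 0 < s → g (r + s) = g r * g s) (hcont : ContinuousOn g (Set.Ioi 0))
    {r : ℝ} (hr : 0 < r) : g r = g 1 ^ r := by
  have hmul : ∀ (n : ℕ) (q : ℝ), 0 < q → g ((n + 1 : ℕ) * q) = g q ^ (n + 1) := by
    intro n q hq
    induction n with
    | zero => simp
    | succ n ih =>
      rw [pow_succ, ← ih, ← hadd _ _ (by positivity) hq]
      congr 1
      push_cast
      ring
  have hrat : ∀ m n : ℕ, g ((m + 1 : ℕ) / (n + 1 : ℕ) : ℝ) = g 1 ^ ((m + 1 : ℕ) / (n + 1 : ℕ) : ℝ) := by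
    intro m n
    set q : ℝ := (m + 1 : ℕ) / (n + 1 : ℕ) with hq
    have hq0 : 0 < q := by positivity
    have h1 : g q ^ (n + 1) = g 1 ^ (m + 1) := by
      rw [← hmul n q hq0, ← hmul m 1 one_pos, hq]
      congr 1
      field_simp
    -- Positivity of g q makes it the unique positive (n+1)-th root of its (n+1)-th power.
    have h2 : (g q ^ ((n + 1 : ℕ) : ℝ)) ^ (1 / (n + 1 : ℕ) : ℝ) = g q := by
      rw [CFC.rpow_rpow_of_exponent_nonneg _ _ _ (by positivity) (by positivity) (hpos q hq0),
        mul_one_div_cancel (by positivity), CFC.rpow_one _ (hpos q hq0)]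
    rw [← h2, CFC.rpow_natCast _ _ (hpos q hq0), h1, ← CFC.rpow_natCast _ _ (hpos 1 one_pos),
      CFC.rpow_rpow_of_exponent_nonneg _ _ _ (by positivity) (by positivity) (hpos 1 one_pos), hq,
      mul_one_div]
  have hdense : Set.Ioi (0 : ℝ) ⊆ closure {q | 0 < q ∧ g q = g 1 ^ q} := by
    intro x hx
    rw [mem_closure_iff_nhds]
    intro U hU
    obtain ⟨l, u, hxlu, hlu⟩ := mem_nhds_iff_exists_Ioo_subset.1 hU
    obtain ⟨q, hq1, hq2⟩ := exists_rat_btwn (show max l 0 < u from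
      max_lt (hxlu.1.trans hxlu.2) (lt_trans hx hxlu.2))
    have hq0 : (0 : ℚ) < q := by exact_mod_cast (le_max_right _ _).trans_lt hq1
    refine ⟨q, hlu ⟨(le_max_left _ _).trans_lt hq1, hq2⟩, by exact_mod_cast hq0, ?_⟩
    -- `hrat` is stated for quotients of successors. The truncated subtraction is harmless since
    -- numerator and denominator are positive.
    have hnum : ((q.num.toNat - 1 + 1 : ℕ) : ℝ) / ((q.den - 1 + 1 : ℕ) : ℝ) = q := by
      have h1 : 0 < q.num := Rat.num_pos.2 hq0
      rw [Nat.sub_add_cancel (by omega), Nat.sub_add_cancel q.den_pos, Rat.cast_def]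
      congr 1
      exact_mod_cast congrArg (Int.cast (R := ℝ)) (Int.toNat_of_nonneg h1.le)
    rw [← hnum]
    exact hrat _ _
  obtain ⟨u, hu, hlim⟩ := mem_closure_iff_seq_limit.1 (hdense hr)
  have hlim' : Filter.Tendsto u Filter.atTop (𝓝[Set.Ioi 0] r) :=
    tendsto_nhdsWithin_iff.2 ⟨hlim, .of_forall fun n => (hu n).1⟩
  refine tendsto_nhds_unique ((hcont r hr).tendsto.comp hlim') ?_
  refine (((continuousOn_rpow_exponent (g 1)) r hr).tendsto.comp hlim').congr fun n => ?_
  exact ((hu n).2).symm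

/-! ### Trace inequalities for powers -/

/-- Polar decomposition W = C S with S = √(W* W). Conjugation by C carries the powers of W* W to
those of W W*, and cyclicity of the trace removes C. -/
lemma opTrace_rpow_star_mul_self (W : H →L[ℂ] H) {r : ℝ} (hr : 0 < r) :
    opTrace ((star W * W) ^ r) = opTrace ((W * star W) ^ r) := by
  set P := star W * W with hP
  have hP0 : 0 ≤ P := star_mul_self_nonneg W
  set S := CFC.sqrt P with hS
  have hSs : IsSelfAdjoint S := sqrt_isSelfAdjoint P
  have hS0 : 0 ≤ S := CFC.sqrt_nonneg P
  have hSS : S * S = P := CFC.sqrt_mul_sqrt_self P hP0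
  obtain ⟨C, hC1, hCS, -⟩ := exists_contraction_factor_of_isSelfAdjoint hSs (P := W) fun x => by
    refine le_of_sq_le_sq ?_ (norm_nonneg _)
    rw [← re_inner_star_mul_self, ← re_inner_mul_self hSs, hSS]
  have hCS' : S * star C = star W := by rw [← hCS, star_mul, hSs.star_eq]
  -- C* C is the identity on the range of S: from S (1 - C* C) S = 0 and 1 - C* C ≥ 0 one gets S (1
  -- - C* C) = 0. Since kernels of powers agree, S may be replaced by S ^ (2q) = P ^ q.
  have hfix : ∀ q : ℝ, 0 < q → star C * C * P ^ q = P ^ q := fun q hq => by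
    have hE : S * (1 - star C * C) * S = 0 := by
      rw [mul_sub, sub_mul, mul_one, hSS, ← mul_assoc, hCS', mul_assoc, hCS, ← hP, sub_self]
    have hpos : 0 ≤ 1 - star C * C := by
      have hn : ‖star C * C‖ ≤ 1 := by
        rw [CStarRing.norm_star_mul_self]; exact mul_le_one₀ hC1 (norm_nonneg _) hC1
      rw [sub_nonneg]
      exact (CStarAlgebra.norm_le_one_iff_of_nonneg _ (star_mul_self_nonneg C)).1 hn
    set E := CFC.sqrt (1 - star C * C) with hEdef
    have hEE : E * E = 1 - star C * C := CFC.sqrt_mul_sqrt_self _ hpos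
    have h1 : E * S = 0 := by
      rw [← CStarRing.star_mul_self_eq_zero_iff, star_mul, hSs.star_eq,
        (sqrt_isSelfAdjoint _).star_eq, mul_assoc, ← mul_assoc E, hEE, ← mul_assoc, hE]
    have h2 : S ^ (1 : ℝ) * (1 - star C * C) = 0 := by
      have := congrArg star h1
      rw [star_mul, hSs.star_eq, (sqrt_isSelfAdjoint _).star_eq, star_zero] at this
      rw [CFC.rpow_one S hS0, ← hEE, ← mul_assoc, this, zero_mul]
    have h3 := rpow_mul_eq_zero hS0 one_pos (show 0 < 2 * q by positivity) h2
    have h4 : S ^ (2 * q) = P ^ q := by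
      rw [hS, CFC.sqrt_eq_rpow,
        CFC.rpow_rpow_of_exponent_nonneg _ _ _ (by positivity) (by positivity) hP0]
      congr 1; ring
    have h5 := congrArg star h3
    rw [h4, star_mul, (rpow_isSelfAdjoint P q).star_eq, star_zero, star_sub, star_mul, star_star,
      star_one, sub_mul, one_mul, sub_eq_zero] at h5
    exact h5.symm
  -- By `hfix`, q ↦ C P ^ q C* is a semigroup, and its value at 1 is W W*.
  have hpow : C * P ^ r * star C = (W * star W) ^ r := by
    have := eq_rpow_of_semigroup (g := fun q => C * P ^ q * star C) (fun q _ => ?_)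
      (fun q s hq hs => ?_) ?_ hr
    · rw [this, CFC.rpow_one P hP0, ← hSS, ← mul_assoc, hCS, mul_assoc, hCS']
    · exact star_right_conjugate_nonneg CFC.rpow_nonneg C
    · rw [rpow_add_of_pos P hq hs]
      calc _ = C * P ^ q * (P ^ s * star C) := by simp only [mul_assoc]
        _ = C * P ^ q * (star C * C * P ^ s * star C) := by rw [hfix s hs]
        _ = _ := by simp only [mul_assoc]
    · exact (continuousOn_const.mul (continuousOn_rpow_exponent P)).mul continuousOn_const
  have h := opTrace_star_mul_self (C * P ^ (r / 2))
  rw [star_mul, (rpow_isSelfAdjoint P _).star_eq] at h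
  calc opTrace (P ^ r) = opTrace (P ^ (r / 2) * star C * (C * P ^ (r / 2))) := by
        rw [mul_assoc, ← mul_assoc (star C), hfix _ (by positivity), rpow_half_mul_self P hr]
    _ = opTrace (C * (P ^ (r / 2) * P ^ (r / 2)) * star C) := by rw [h]; simp only [mul_assoc]
    _ = _ := by rw [rpow_half_mul_self P hr, hpow]

/-- This exchanges the outer and the middle operator, so that either of them can be made to enter
linearly. -/
lemma opTrace_rpow_conj_comm {A M : H →L[ℂ] H} (hA : 0 ≤ A) (hM : 0 ≤ M) {r : ℝ} (hr : 0 < r) :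
    opTrace ((CFC.sqrt A * M * CFC.sqrt A) ^ r) = opTrace ((CFC.sqrt M * A * CFC.sqrt M) ^ r) := by
  have h := opTrace_rpow_star_mul_self (CFC.sqrt M * CFC.sqrt A) hr
  rw [star_mul, (sqrt_isSelfAdjoint A).star_eq, (sqrt_isSelfAdjoint M).star_eq] at h
  rw [show CFC.sqrt A * M * CFC.sqrt A = CFC.sqrt A * CFC.sqrt M * (CFC.sqrt M * CFC.sqrt A) by
    conv_lhs => rw [← CFC.sqrt_mul_sqrt_self M hM]
    simp only [mul_assoc], h]
  conv_rhs => rw [← CFC.sqrt_mul_sqrt_self A hA]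
  simp only [mul_assoc]

/-- For r ≤ 1 the power itself is operator monotone. For larger r the exponent is halved through T ^
r = (√T T √T) ^ (r/2): replace the middle Z by Y in √Z Z √Z, swap the roles to reach √Y Z √Y, and
replace Z by Y once more. -/
lemma opTrace_rpow_mono {Z Y : H →L[ℂ] H} (hZ : 0 ≤ Z) (h : Z ≤ Y) {r : ℝ} (hr : 0 < r) :
    opTrace (Z ^ r) ≤ opTrace (Y ^ r) := by
  have key : ∀ n : ℕ, ∀ r : ℝ, 0 < r → r ≤ 2 ^ n → ∀ Z Y : H →L[ℂ] H, 0 ≤ Z → Z ≤ Y →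
      opTrace (Z ^ r) ≤ opTrace (Y ^ r) := by
    intro n
    induction n with
    | zero =>
      intro r hr hr1 Z Y _ h
      exact opTrace_mono (CFC.rpow_le_rpow ⟨hr.le, by simpa using hr1⟩ h)
    | succ n ih =>
      intro r hr hr1 Z Y hZ h
      have hY : 0 ≤ Y := hZ.trans h
      have hr2 : 0 < r / 2 := by positivity
      have hrn : r / 2 ≤ 2 ^ n := by rw [pow_succ] at hr1; linarith
      have hsq : ∀ T : H →L[ℂ] H, 0 ≤ T →
          T ^ r = (CFC.sqrt T * T * CFC.sqrt T) ^ (r / 2) := fun T hT => by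
        have e : CFC.sqrt T * T * CFC.sqrt T = T ^ (2 : ℝ) := by
          conv_lhs => enter [1, 2]; rw [← CFC.sqrt_mul_sqrt_self T hT]
          rw [← mul_assoc, CFC.sqrt_mul_sqrt_self T hT, mul_assoc, CFC.sqrt_mul_sqrt_self T hT,
            show (2 : ℝ) = 1 + 1 by norm_num, rpow_add_of_pos T one_pos one_pos, CFC.rpow_one T hT]
        rw [e, CFC.rpow_rpow_of_exponent_nonneg _ _ _ (by positivity) hr2.le hT]
        congr 1; ring
      rw [hsq Z hZ, hsq Y hY]
      refine (ih _ hr2 hrn _ _ (conj_nonneg hZ (sqrt_isSelfAdjoint Z))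
        (conj_le_conj h (sqrt_isSelfAdjoint Z))).trans ?_
      rw [opTrace_rpow_conj_comm hZ hY hr2]
      exact ih _ hr2 hrn _ _ (conj_nonneg hZ (sqrt_isSelfAdjoint Y))
        (conj_le_conj h (sqrt_isSelfAdjoint Y))
  obtain ⟨n, hn⟩ := pow_unbounded_of_one_lt r (one_lt_two (α := ℝ))
  exact key n r hr hn.le Z Y hZ h

lemma opTrace_rpow_star_conj_le {A C : H →L[ℂ] H} (hA : 0 ≤ A) (hC : ‖C‖ ≤ 1) {r : ℝ}
    (hr : 0 < r) : opTrace ((star C * A * C) ^ r) ≤ opTrace (A ^ r) := by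
  have h := opTrace_rpow_star_mul_self (CFC.sqrt A * C) hr
  rw [star_mul, (sqrt_isSelfAdjoint A).star_eq] at h
  have h2 : star C * A * C = star C * CFC.sqrt A * (CFC.sqrt A * C) := by
    conv_lhs => rw [← CFC.sqrt_mul_sqrt_self A hA]
    simp only [mul_assoc]
  rw [h2, h, show CFC.sqrt A * C * (star C * CFC.sqrt A)
    = CFC.sqrt A * (C * star C) * CFC.sqrt A by simp only [mul_assoc]]
  have hn : C * star C ≤ 1 := by
    refine (CStarAlgebra.norm_le_one_iff_of_nonneg _ (mul_star_self_nonneg C)).1 ?_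
    rw [CStarRing.norm_self_mul_star]; exact mul_le_one₀ hC (norm_nonneg _) hC
  refine opTrace_rpow_mono (conj_nonneg (mul_star_self_nonneg C) (sqrt_isSelfAdjoint A)) ?_ hr
  refine (conj_le_conj hn (sqrt_isSelfAdjoint A)).trans_eq ?_
  rw [mul_one, CFC.sqrt_mul_sqrt_self A hA]

/-- Subadditivity of `X ↦ tr (X ^ a)` for `a < 1` (McCarthy, Rotfel'd). -/
lemma opTrace_rpow_add_le {X Y : H →L[ℂ] H} (hX : 0 ≤ X) (hY : 0 ≤ Y) {a : ℝ} (ha : 0 < a)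
    (ha1 : a < 1) : opTrace ((X + Y) ^ a) ≤ opTrace (X ^ a) + opTrace (Y ^ a) := by
  set Z := X + Y with hZdef
  have hZ : 0 ≤ Z := add_nonneg hX hY
  -- With this b, T = T ^ b T ^ a T ^ b, and 2b ≤ 1 permits factorizations X ^ b = E Z ^ b and Y ^ b
  -- = F Z ^ b with contractions E and F.
  set b := (1 - a) / 2 with hb
  have hb0 : 0 < b := by rw [hb]; linarith
  obtain ⟨E, hE1, hEZ, hEd⟩ := exists_contraction_rpow hZ (le_add_of_nonneg_right hY)
    hb0 (by linarith)
  obtain ⟨F, hF1, hFZ, hFd⟩ := exists_contraction_rpow hZ (le_add_of_nonneg_left hX)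
    hb0 (by linarith)
  have split : ∀ T : H →L[ℂ] H, 0 ≤ T → T ^ b * T ^ a * T ^ b = T := fun T hT => by
    rw [← rpow_add_of_pos T hb0 ha, ← rpow_add_of_pos T (by linarith) hb0]
    conv_rhs => rw [← CFC.rpow_one T hT]
    congr 1; rw [hb]; ring
  have conj : ∀ T G : H →L[ℂ] H, 0 ≤ T → G * Z ^ b = T ^ b →
      Z ^ b * (star G * T ^ a * G) * Z ^ b = T := fun T G hT hG => by
    have hG' : Z ^ b * star G = T ^ b := by
      rw [← (rpow_isSelfAdjoint T b).star_eq, ← hG, star_mul, (rpow_isSelfAdjoint Z b).star_eq]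
    calc _ = Z ^ b * star G * T ^ a * (G * Z ^ b) := by simp only [mul_assoc]
      _ = T := by rw [hG, hG', split T hT]
  have hXp : 0 ≤ star E * X ^ a * E := star_left_conjugate_nonneg CFC.rpow_nonneg E
  have hYp : 0 ≤ star F * Y ^ a * F := star_left_conjugate_nonneg CFC.rpow_nonneg F
  -- Compressing with Z ^ b turns both sides into Z = X + Y, and both vanish on ker Z, so they
  -- coincide.
  have hZa : Z ^ a = star E * X ^ a * E + star F * Y ^ a * F := by
    refine eq_of_conj_eq (rpow_isSelfAdjoint Z b) (rpow_isSelfAdjoint Z a)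
      (add_nonneg hXp hYp).isSelfAdjoint (fun x hx => ?_) (fun x hx => ?_) ?_
    · rwa [rpow_apply_eq_zero_iff hZ ha, ← rpow_apply_eq_zero_iff hZ hb0]
    · have hZx := (rpow_apply_eq_zero_iff hZ hb0 x).1 hx
      simp [mul_apply_eq_comp, hEd x hZx, hFd x hZx]
    · rw [split Z hZ, mul_add, add_mul, conj X E hX hEZ, conj Y F hY hFZ]
  rw [hZa, opTrace_add hXp hYp]
  exact add_le_add (opTrace_star_conj_le CFC.rpow_nonneg hE1)
    (opTrace_star_conj_le CFC.rpow_nonneg hF1)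

end Powers

/-! ### The sandwiched trace: monotonicity, unitary invariance, normalization. -/

section Divergence

variable {H : Type*} [NormedAddCommGroup H] [InnerProductSpace ℂ H] [CompleteSpace H]
variable {K : Type*} [NormedAddCommGroup K] [InnerProductSpace ℂ K] [CompleteSpace K]

variable {α : ℝ} {A B X Y : H →L[ℂ] H}

/-! ### The trace functional of the sandwiched operator -/

lemma isSandwich_iff_of_one_lt (hα : 1 < α) :
    IsSandwich α A B X ↔
      0 ≤ X ∧ Dominates B X ∧ B ^ ((α - 1) / (2 * α)) * X * B ^ ((α - 1) / (2 * α)) = A := by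
  rw [IsSandwich, if_neg hα.not_gt]

lemma exponent_pos (hα : 1 < α) : 0 < (α - 1) / (2 * α) :=
  div_pos (by linarith) (by linarith)

lemma two_mul_exponent_le_one (hα : 1 < α) : 2 * ((α - 1) / (2 * α)) ≤ 1 := by
  rw [mul_div_mul_left _ _ two_ne_zero |>.symm.trans (mul_div_assoc _ _ _) |>.symm,
    div_le_one (by linarith)]
  linarith

lemma exponent_pos_of_lt_one (hα : 1 / 2 ≤ α) (hα1 : α < 1) : 0 < (1 - α) / (2 * α) :=
  div_pos (by linarith) (by linarith)

/-- This is what the bound α ≥ 1/2 is for: it keeps the exponent (1-α)/α within the range of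
operator monotonicity. -/
lemma two_mul_exponent_le_one_of_lt_one (hα : 1 / 2 ≤ α) :
    2 * ((1 - α) / (2 * α)) ≤ 1 := by
  rw [mul_div_mul_left _ _ two_ne_zero |>.symm.trans (mul_div_assoc _ _ _) |>.symm,
    div_le_one (by linarith)]
  linarith

lemma IsSandwich.unique (hα : 1 < α) (hX : IsSandwich α A B X)
    (hY : IsSandwich α A B Y) (hB : 0 ≤ B) : X = Y := by
  rw [isSandwich_iff_of_one_lt hα] at hX hY
  have ht := exponent_pos hα
  refine eq_of_conj_eq (rpow_isSelfAdjoint B _) hX.1.isSelfAdjoint hY.1.isSelfAdjoint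
    (fun x hx => hX.2.1 x ?_) (fun x hx => hY.2.1 x ?_) (hX.2.2.trans hY.2.2.symm) <;>
  exact (rpow_apply_eq_zero_iff hB ht x).1 hx

lemma IsSandwich.sandwichTrace_eq (hα : 1 < α) (hX : IsSandwich α A B X) (hB : 0 ≤ B) :
    sandwichTrace α A B = opTrace (X ^ α) :=
  le_antisymm (iInf₂_le X hX) (le_iInf₂ fun Y hY => by rw [hX.unique hα hY hB])

lemma sandwichTrace_eq_top (h : ¬ ∃ X, IsSandwich α A B X) : sandwichTrace α A B = ∞ := by
  rw [sandwichTrace, iInf₂_eq_top]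
  exact fun X hX => (h ⟨X, hX⟩).elim

lemma sandwichTrace_of_lt_one (hα1 : α < 1) : sandwichTrace α A B =
    opTrace ((B ^ ((1 - α) / (2 * α)) * A * B ^ ((1 - α) / (2 * α))) ^ α) := by
  simp only [sandwichTrace, IsSandwich, if_pos hα1, iInf_iInf_eq_left]

/-- With the whole power of B in the middle, monotonicity and continuity in B can be read off. -/
lemma sandwichTrace_of_lt_one_symm (hα : 1 / 2 ≤ α) (hα1 : α < 1) (hA : 0 ≤ A) :
    sandwichTrace α A B =
      opTrace ((CFC.sqrt A * B ^ (2 * ((1 - α) / (2 * α))) * CFC.sqrt A) ^ α) := by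
  have hs := exponent_pos_of_lt_one hα hα1
  rw [sandwichTrace_of_lt_one hα1, opTrace_rpow_conj_comm hA CFC.rpow_nonneg (by linarith),
    sqrt_rpow_of_pos B (by positivity), mul_div_cancel_left₀ _ two_ne_zero]

lemma sandwichTrace_mono (hα : 1 / 2 ≤ α) (hα1 : α < 1) (hA : 0 ≤ A) {B' : H →L[ℂ] H}
    (h : B ≤ B') : sandwichTrace α A B ≤ sandwichTrace α A B' := by
  have hs := exponent_pos_of_lt_one hα hα1
  rw [sandwichTrace_of_lt_one_symm hα hα1 hA, sandwichTrace_of_lt_one_symm hα hα1 hA]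
  refine opTrace_mono (CFC.rpow_le_rpow ⟨by linarith, hα1.le⟩ (conj_le_conj ?_ (sqrt_isSelfAdjoint A)))
  exact CFC.rpow_le_rpow ⟨by positivity, two_mul_exponent_le_one_of_lt_one hα⟩ h

/-- Write B ^ t = C B' ^ t with a contraction C, where t = (α-1)/(2α). If X is a sandwich for (A,
B), then C* X C is one for (A, B'), and conjugation by C does not increase the trace of the α-th
power. If no X exists, the right side is ∞. -/
lemma sandwichTrace_anti (hα : 1 < α) {B' : H →L[ℂ] H} (hB : 0 ≤ B)
    (h : B ≤ B') : sandwichTrace α A B' ≤ sandwichTrace α A B := by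
  refine le_iInf₂ fun X hX => ?_
  rw [isSandwich_iff_of_one_lt hα] at hX
  obtain ⟨C, hC1, hCB, hCd⟩ := exists_contraction_rpow (hB.trans h) h (exponent_pos hα)
    (two_mul_exponent_le_one hα)
  have hCB' := congrArg star hCB
  rw [star_mul, (rpow_isSelfAdjoint B _).star_eq, (rpow_isSelfAdjoint B' _).star_eq] at hCB'
  refine (iInf₂_le (star C * X * C) ?_).trans (opTrace_rpow_star_conj_le hX.1 hC1 (by linarith))
  refine (isSandwich_iff_of_one_lt hα).2 ⟨star_left_conjugate_nonneg hX.1 C, fun x hx => ?_, ?_⟩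
  · simp [mul_apply_eq_comp, hCd x hx]
  · rw [← hX.2.2, ← hCB]
    conv_rhs => enter [1, 1]; rw [hCB, ← hCB']
    simp only [mul_assoc]

/-- The sandwich is A ^ (1/α) on both sides of α = 1, even when A is not invertible. -/
lemma sandwichTrace_self (hα : 1 / 2 ≤ α) (hα1 : α ≠ 1) (hA : 0 ≤ A) :
    sandwichTrace α A A = opTrace A := by
  have h0 : 0 < α := by linarith
  have hpow : (A ^ (1 / α)) ^ α = A := by
    rw [CFC.rpow_rpow_of_exponent_nonneg A _ _ (by positivity) h0.le hA, one_div_mul_cancel h0.ne',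
      CFC.rpow_one A hA]
  rcases lt_or_gt_of_ne hα1 with h1 | h1
  · have hs := exponent_pos_of_lt_one hα h1
    have e : A ^ ((1 - α) / (2 * α)) * A * A ^ ((1 - α) / (2 * α)) = A ^ (1 / α) := by
      conv_lhs => enter [1, 2]; rw [← CFC.rpow_one A hA]
      rw [← rpow_add_of_pos A hs one_pos, ← rpow_add_of_pos A (by positivity) hs]
      congr 1
      field_simp
      ring
    rw [sandwichTrace_of_lt_one h1, e, hpow]
  · have ht := exponent_pos h1
    have hX : IsSandwich α A A (A ^ (1 / α)) := by
      refine (isSandwich_iff_of_one_lt h1).2 ⟨CFC.rpow_nonneg, fun x hx => ?_, ?_⟩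
      · rwa [rpow_apply_eq_zero_iff hA (by positivity)]
      · rw [← rpow_add_of_pos A ht (by positivity), ← rpow_add_of_pos A (by positivity) ht]
        conv_rhs => rw [← CFC.rpow_one A hA]
        congr 1
        field_simp
        ring
    rw [hX.sandwichTrace_eq h1 hA, hpow]

/-- For α < 1, a vanishing sandwich forces B ^ s √A = 0, where s = (1-α)/(2α); by domination A √A =
0, hence A = 0. Nonvanishing excludes products 0 · ∞ and sums of opposite infinities for tensor
products. -/
lemma sandwichTrace_ne_zero (hα : 1 / 2 ≤ α) (hα1 : α ≠ 1) (hA : 0 ≤ A) (hA0 : A ≠ 0)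
    (hB : 0 ≤ B) (hBA : Dominates B A) : sandwichTrace α A B ≠ 0 := by
  have h0 : 0 < α := by linarith
  intro h
  have hzero : ∀ X : H →L[ℂ] H, 0 ≤ X → opTrace (X ^ α) = 0 → X = 0 := fun X hX hX0 => by
    have := eq_zero_of_opTrace_eq_zero CFC.rpow_nonneg hX0
    ext x
    rw [zero_apply, ← rpow_apply_eq_zero_iff hX h0, this, zero_apply]
  rcases lt_or_gt_of_ne hα1 with h1 | h1
  · have hs := exponent_pos_of_lt_one hα h1
    rw [sandwichTrace_of_lt_one h1] at h
    have h2 := hzero _ (conj_nonneg hA (rpow_isSelfAdjoint B _)) h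
    have h3 : CFC.sqrt A * B ^ ((1 - α) / (2 * α)) = 0 := by
      rw [← CStarRing.star_mul_self_eq_zero_iff, star_mul, (sqrt_isSelfAdjoint A).star_eq,
        (rpow_isSelfAdjoint B _).star_eq, mul_assoc, ← mul_assoc (CFC.sqrt A),
        CFC.sqrt_mul_sqrt_self A hA, ← mul_assoc, h2]
    have h4 := congrArg star h3
    rw [star_mul, (sqrt_isSelfAdjoint A).star_eq, (rpow_isSelfAdjoint B _).star_eq,
      star_zero] at h4
    have h5 : A * CFC.sqrt A = 0 := by
      ext x
      refine hBA _ ((rpow_apply_eq_zero_iff hB hs _).1 (DFunLike.congr_fun h4 x))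
    refine hA0 (eq_zero_of_mul_self hA.isSelfAdjoint ?_)
    conv_lhs => enter [2]; rw [← CFC.sqrt_mul_sqrt_self A hA]
    rw [← mul_assoc, h5, zero_mul]
  · by_cases hex : ∃ X, IsSandwich α A B X
    · obtain ⟨X, hX⟩ := hex
      rw [hX.sandwichTrace_eq h1 hB] at h
      rw [isSandwich_iff_of_one_lt h1] at hX
      exact hA0 (by rw [← hX.2.2, hzero X hX.1 h, mul_zero, zero_mul])
    · rw [sandwichTrace_eq_top hex] at h
      exact ENNReal.top_ne_zero h

/-! ### Order -/

lemma coe_mul_le_coe_mul_of_nonneg {c : ℝ} (hc : 0 ≤ c) {x y : EReal} (h : x ≤ y) :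
    (c : EReal) * x ≤ c * y :=
  mul_le_mul_of_nonneg_left h (by exact_mod_cast hc)

lemma coe_mul_le_coe_mul_of_nonpos {c : ℝ} (hc : c ≤ 0) {x y : EReal} (h : x ≤ y) :
    (c : EReal) * y ≤ c * x := by
  have := coe_mul_le_coe_mul_of_nonneg (neg_nonneg.2 hc) h
  rwa [EReal.coe_neg, EReal.neg_mul, EReal.neg_mul, EReal.neg_le_neg_iff] at this

/-- The divergence is antitone in its second argument. -/
lemma renyiDiv_anti (hα : 1 / 2 ≤ α) (hα1 : α ≠ 1) (hA : 0 ≤ A) {B' : H →L[ℂ] H} (hB : 0 ≤ B)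
    (h : B ≤ B') : renyiDiv α A B' ≤ renyiDiv α A B := by
  rcases lt_or_gt_of_ne hα1 with h1 | h1
  -- For α < 1 the trace increases with B, and the negative factor 1/(α-1) reverses the inequality.
  · refine coe_mul_le_coe_mul_of_nonpos ?_ (ENNReal.log_monotone (ENNReal.div_le_div_right
      (sandwichTrace_mono hα h1 hA h) _))
    exact one_div_nonpos.2 (by linarith)
  · refine coe_mul_le_coe_mul_of_nonneg ?_ (ENNReal.log_monotone (ENNReal.div_le_div_right
      (sandwichTrace_anti h1 hB h) _))
    exact one_div_nonneg.2 (by linarith)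

lemma IsPosTraceClass.opTrace_ne_zero (hA : IsPosTraceClass A) : opTrace A ≠ 0 :=
  fun h => hA.2.1 (eq_zero_of_opTrace_eq_zero hA.1 h)

lemma renyiDiv_self (hα : 1 / 2 ≤ α) (hα1 : α ≠ 1) (hA : IsPosTraceClass A) :
    renyiDiv α A A = 0 := by
  rw [renyiDiv, sandwichTrace_self hα hα1 hA.1, ENNReal.div_self hA.opTrace_ne_zero hA.2.2.ne,
    ENNReal.log_one, mul_zero]

lemma smul_one_eq_algebraMap (c : ℝ) :
    (c : ℂ) • (1 : H →L[ℂ] H) = algebraMap ℝ (H →L[ℂ] H) c := by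
  rw [IsScalarTower.algebraMap_apply ℝ ℂ (H →L[ℂ] H), Algebra.algebraMap_eq_smul_one]
  rfl

lemma smul_one_nonneg {c : ℝ} (hc : 0 ≤ c) : 0 ≤ (c : ℂ) • (1 : H →L[ℂ] H) := by
  rw [smul_one_eq_algebraMap]
  exact algebraMap_nonneg _ hc

lemma add_smul_one_nonneg (hB : 0 ≤ B) {lam : ℝ} (hl : 0 ≤ lam) :
    0 ≤ B + (lam : ℂ) • (1 : H →L[ℂ] H) := add_nonneg hB (smul_one_nonneg hl)

lemma regRenyiDiv_zero : regRenyiDiv α 0 A B = renyiDiv α A B := by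
  simp [regRenyiDiv]

/-! ### Unitary invariance -/

lemma star_mul_self_mul_of_unitary {U : H →L[ℂ] H} (hU : U ∈ unitary (H →L[ℂ] H))
    (T : H →L[ℂ] H) : star U * (U * T) = T := by
  rw [← mul_assoc, (Unitary.mem_iff.1 hU).1, one_mul]

lemma unitary_conj_mul {U : H →L[ℂ] H} (hU : U ∈ unitary (H →L[ℂ] H)) (S T : H →L[ℂ] H) :
    U * S * star U * (U * T * star U) = U * (S * T) * star U := by
  simp only [mul_assoc, star_mul_self_mul_of_unitary hU]

lemma unitary_conj_rpow {U : H →L[ℂ] H} (hU : U ∈ unitary (H →L[ℂ] H)) (hB : 0 ≤ B) {r : ℝ}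
    (hr : 0 < r) : (U * B * star U) ^ r = U * B ^ r * star U := by
  have := eq_rpow_of_semigroup (g := fun q => U * B ^ q * star U)
    (fun q _ => star_right_conjugate_nonneg CFC.rpow_nonneg U)
    (fun q s hq hs => by rw [unitary_conj_mul hU, rpow_add_of_pos B hq hs])
    ((continuousOn_const.mul (continuousOn_rpow_exponent B)).mul continuousOn_const) hr
  rw [this, CFC.rpow_one B hB]

lemma opTrace_unitary_conj {U : H →L[ℂ] H} (hU : U ∈ unitary (H →L[ℂ] H)) (hA : 0 ≤ A) :
    opTrace (U * A * star U) = opTrace A := by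
  have h := opTrace_star_mul_self (CFC.sqrt A * star U)
  rw [star_mul, star_star, (sqrt_isSelfAdjoint A).star_eq] at h
  rw [show U * A * star U = U * CFC.sqrt A * (CFC.sqrt A * star U) by
    conv_lhs => rw [← CFC.sqrt_mul_sqrt_self A hA]
    simp only [mul_assoc], h, mul_assoc, star_mul_self_mul_of_unitary hU,
    CFC.sqrt_mul_sqrt_self A hA]

lemma sandwichTrace_unitary_le (hα : 1 / 2 ≤ α) (hα1 : α ≠ 1) {U : H →L[ℂ] H}
    (hU : U ∈ unitary (H →L[ℂ] H)) (hA : 0 ≤ A) (hB : 0 ≤ B) :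
    sandwichTrace α (U * A * star U) (U * B * star U) ≤ sandwichTrace α A B := by
  have h0 : 0 < α := by linarith
  rcases lt_or_gt_of_ne hα1 with h1 | h1
  · have hs := exponent_pos_of_lt_one hα h1
    rw [sandwichTrace_of_lt_one h1, sandwichTrace_of_lt_one h1, unitary_conj_rpow hU hB hs,
      unitary_conj_mul hU, unitary_conj_mul hU,
      unitary_conj_rpow hU (conj_nonneg hA (rpow_isSelfAdjoint B _)) h0,
      opTrace_unitary_conj hU CFC.rpow_nonneg]
  · refine le_iInf₂ fun X hX => ?_
    rw [isSandwich_iff_of_one_lt h1] at hX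
    refine (iInf₂_le (U * X * star U) ?_).trans_eq ?_
    · refine (isSandwich_iff_of_one_lt h1).2
        ⟨star_right_conjugate_nonneg hX.1 U, fun x hx => ?_, ?_⟩
      · have hx' : B (star U x) = 0 := by
          have : star U ((U * B * star U) x) = star U 0 := by rw [hx]
          rwa [map_zero, ← mul_apply_eq_comp, mul_assoc, star_mul_self_mul_of_unitary hU] at this
        rw [mul_apply_eq_comp, mul_apply_eq_comp, hX.2.1 _ hx', map_zero]
      · rw [unitary_conj_rpow hU hB (exponent_pos h1), unitary_conj_mul hU, unitary_conj_mul hU,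
          hX.2.2]
    · rw [unitary_conj_rpow hU hX.1 h0, opTrace_unitary_conj hU CFC.rpow_nonneg]

lemma sandwichTrace_unitary (hα : 1 / 2 ≤ α) (hα1 : α ≠ 1) {U : H →L[ℂ] H}
    (hU : U ∈ unitary (H →L[ℂ] H)) (hA : 0 ≤ A) (hB : 0 ≤ B) :
    sandwichTrace α (U * A * star U) (U * B * star U) = sandwichTrace α A B := by
  refine (sandwichTrace_unitary_le hα hα1 hU hA hB).antisymm ?_
  -- The reverse inequality is the same bound for U* and the conjugated pair.
  have h := sandwichTrace_unitary_le hα hα1 (Unitary.star_mem hU)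
    (star_right_conjugate_nonneg hA U) (star_right_conjugate_nonneg hB U)
  have e : ∀ T : H →L[ℂ] H, star U * (U * T * star U) * star (star U) = T := fun T => by
    rw [star_star, mul_assoc (star U), mul_assoc U, mul_assoc U, star_mul_self_mul_of_unitary hU,
      mul_assoc, (Unitary.mem_iff.1 hU).1, mul_one]
  rwa [e, e] at h

lemma regRenyiDiv_unitary (hα : 1 / 2 ≤ α) (hα1 : α ≠ 1) {U : H →L[ℂ] H}
    (hU : U ∈ unitary (H →L[ℂ] H)) (hA : 0 ≤ A) (hB : 0 ≤ B) {lam : ℝ} (hl : 0 ≤ lam) :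
    regRenyiDiv α lam A B = regRenyiDiv α lam (U * A * star U) (U * B * star U) := by
  have e : U * B * star U + (lam : ℂ) • (1 : H →L[ℂ] H)
      = U * (B + (lam : ℂ) • (1 : H →L[ℂ] H)) * star U := by
    rw [mul_add, add_mul, mul_smul_comm, smul_mul_assoc, mul_one, (Unitary.mem_iff.1 hU).2]
  rw [regRenyiDiv, regRenyiDiv, renyiDiv, renyiDiv, e,
    sandwichTrace_unitary hα hα1 hU hA (add_smul_one_nonneg hB hl), opTrace_unitary_conj hU hA]

/-! ### Normalization -/

lemma smul_one_rpow {c : ℝ} (hc : 0 < c) (r : ℝ) :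
    ((c : ℂ) • (1 : H →L[ℂ] H)) ^ r = ((c ^ r : ℝ) : ℂ) • (1 : H →L[ℂ] H) := by
  have e : ∀ d : NNReal, ((d : ℝ) : ℂ) • (1 : H →L[ℂ] H) = algebraMap NNReal (H →L[ℂ] H) d :=
    fun d => by rw [smul_one_eq_algebraMap]; rfl
  lift c to NNReal using hc.le
  rw [e, CFC.rpow_algebraMap, ← NNReal.coe_rpow, e]

lemma isUnit_smul_one {c : ℝ} (hc : 0 < c) : IsUnit ((c : ℂ) • (1 : H →L[ℂ] H)) := by
  rw [← Algebra.algebraMap_eq_smul_one]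
  exact (IsUnit.mk0 (c : ℂ) (by exact_mod_cast hc.ne')).map _

lemma opTrace_one_complex : opTrace (1 : ℂ →L[ℂ] ℂ) = 1 := by
  let b := (OrthonormalBasis.singleton Unit ℂ).toHilbertBasis
  rw [opTrace_eq_tsum b zero_le_one, tsum_fintype]
  simp [b]

lemma regRenyiDiv_one_half (hα : 1 / 2 ≤ α) (hα1 : α ≠ 1) {lam : ℝ} (hl : 0 ≤ lam) :
    regRenyiDiv α lam (1 : ℂ →L[ℂ] ℂ) ((1 / 2 : ℂ) • (1 : ℂ →L[ℂ] ℂ))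
      = ((-Real.log (1 / 2 + lam) : ℝ) : EReal) := by
  have hc : 0 < 1 / 2 + lam := by positivity
  have e : (1 / 2 : ℂ) • (1 : ℂ →L[ℂ] ℂ) + (lam : ℂ) • (1 : ℂ →L[ℂ] ℂ)
      = ((1 / 2 + lam : ℝ) : ℂ) • (1 : ℂ →L[ℂ] ℂ) := by
    push_cast
    exact (add_smul _ _ _).symm
  have h1 : (((1 / 2 + lam) ^ ((1 - α) / (2 * α)) * (1 / 2 + lam) ^ ((1 - α) / (2 * α))) ^ α : ℝ)
      = (1 / 2 + lam) ^ (1 - α) := by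
    rw [← Real.rpow_add hc, ← Real.rpow_mul hc.le]
    congr 1
    field_simp
    ring
  have hne := sub_ne_zero.2 hα1
  rw [regRenyiDiv, e, renyiDiv, sandwichTrace_of_isUnit zero_le_one (smul_one_nonneg hc.le)
    (isUnit_smul_one hc), smul_one_rpow hc, mul_one, smul_mul_smul_comm, mul_one,
    ← Complex.ofReal_mul, smul_one_rpow (by positivity), h1, opTrace_smul (by positivity),
    opTrace_one_complex, mul_one, div_one, ENNReal.log_ofReal_of_pos (by positivity),
    Real.log_rpow hc, ← EReal.coe_mul]
  congr 1
  field_simp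
  ring

end Divergence

/-! ### Block operators and the mean property. -/

section DirectSum

variable {H : Type*} [NormedAddCommGroup H] [InnerProductSpace ℂ H] [CompleteSpace H]
variable {K : Type*} [NormedAddCommGroup K] [InnerProductSpace ℂ K] [CompleteSpace K]

variable {α : ℝ} {A B : H →L[ℂ] H} {C D : K →L[ℂ] K}

open ContinuousLinearMap (adjoint)

/-! ### Direct sums -/

variable (H K) in
/-- The isometry `x ↦ (x, 0)`. -/
def sumInl : H →L[ℂ] WithLp 2 (H × K) :=
  ((WithLp.prodContinuousLinearEquiv 2 ℂ H K).symm : H × K →L[ℂ] WithLp 2 (H × K)) ∘L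
    ContinuousLinearMap.inl ℂ H K

variable (H K) in
/-- The isometry `y ↦ (0, y)`. -/
def sumInr : K →L[ℂ] WithLp 2 (H × K) :=
  ((WithLp.prodContinuousLinearEquiv 2 ℂ H K).symm : H × K →L[ℂ] WithLp 2 (H × K)) ∘L
    ContinuousLinearMap.inr ℂ H K

lemma sumInl_apply (x : H) : sumInl H K x = WithLp.toLp 2 (x, 0) := rfl

lemma sumInr_apply (y : K) : sumInr H K y = WithLp.toLp 2 (0, y) := rfl

lemma opSum_apply (A : H →L[ℂ] H) (C : K →L[ℂ] K) (z : WithLp 2 (H × K)) :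
    opSum A C z = WithLp.toLp 2 (A z.fst, C z.snd) := rfl

lemma adjoint_sumInl_apply (z : WithLp 2 (H × K)) : adjoint (sumInl H K) z = z.fst := by
  refine ext_inner_left ℂ fun x => ?_
  rw [ContinuousLinearMap.adjoint_inner_right, sumInl_apply, WithLp.prod_inner_apply]
  simp

lemma adjoint_sumInr_apply (z : WithLp 2 (H × K)) : adjoint (sumInr H K) z = z.snd := by
  refine ext_inner_left ℂ fun x => ?_
  rw [ContinuousLinearMap.adjoint_inner_right, sumInr_apply, WithLp.prod_inner_apply]
  simp

lemma sum_ext {S T : WithLp 2 (H × K) →L[ℂ] WithLp 2 (H × K)}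
    (h₁ : ∀ z, (S z).fst = (T z).fst) (h₂ : ∀ z, (S z).snd = (T z).snd) : S = T := by
  ext z
  exact WithLp.ofLp_injective 2 (Prod.ext (h₁ z) (h₂ z))

/-- Writing the sum through the two inclusions reduces positivity, trace and continuity to the
single blocks. -/
lemma opSum_eq (A : H →L[ℂ] H) (C : K →L[ℂ] K) :
    opSum A C = sumInl H K ∘L A ∘L adjoint (sumInl H K)
      + sumInr H K ∘L C ∘L adjoint (sumInr H K) := by
  refine sum_ext (fun z => ?_) (fun z => ?_) <;>
  simp [opSum_apply, adjoint_sumInl_apply, adjoint_sumInr_apply, sumInl_apply, sumInr_apply]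

lemma opSum_mul (A A' : H →L[ℂ] H) (C C' : K →L[ℂ] K) :
    opSum A C * opSum A' C' = opSum (A * A') (C * C') :=
  sum_ext (fun _ => rfl) (fun _ => rfl)

lemma opSum_add_smul_one (A : H →L[ℂ] H) (C : K →L[ℂ] K) (c : ℂ) :
    opSum (A + c • 1) (C + c • 1) = opSum A C + c • 1 :=
  sum_ext (fun _ => rfl) (fun _ => rfl)

lemma adjoint_sumInl_comp_opSum (A : H →L[ℂ] H) (C : K →L[ℂ] K) :
    adjoint (sumInl H K) ∘L opSum A C = A ∘L adjoint (sumInl H K) := by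
  ext z
  simp [adjoint_sumInl_apply, opSum_apply]

lemma adjoint_sumInr_comp_opSum (A : H →L[ℂ] H) (C : K →L[ℂ] K) :
    adjoint (sumInr H K) ∘L opSum A C = C ∘L adjoint (sumInr H K) := by
  ext z
  simp [adjoint_sumInr_apply, opSum_apply]

lemma opSum_comp_sumInl (A : H →L[ℂ] H) (C : K →L[ℂ] K) :
    opSum A C ∘L sumInl H K = sumInl H K ∘L A := by
  ext z
  simp [sumInl_apply, opSum_apply]

lemma opSum_comp_sumInr (A : H →L[ℂ] H) (C : K →L[ℂ] K) :
    opSum A C ∘L sumInr H K = sumInr H K ∘L C := by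
  ext z
  simp [sumInr_apply, opSum_apply]

lemma adjoint_sumInl_comp_sumInl : adjoint (sumInl H K) ∘L sumInl H K = 1 := by
  ext x
  simp [adjoint_sumInl_apply, sumInl_apply]

lemma adjoint_sumInr_comp_sumInr : adjoint (sumInr H K) ∘L sumInr H K = 1 := by
  ext x
  simp [adjoint_sumInr_apply, sumInr_apply]

lemma conj_comp_nonneg {H K : Type*} [NormedAddCommGroup H] [InnerProductSpace ℂ H]
    [CompleteSpace H] [NormedAddCommGroup K] [InnerProductSpace ℂ K] [CompleteSpace K]
    {A : H →L[ℂ] H} (hA : 0 ≤ A) (S : H →L[ℂ] K) : 0 ≤ S ∘L A ∘L adjoint S :=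
  (ContinuousLinearMap.nonneg_iff_isPositive _).2
    (((ContinuousLinearMap.nonneg_iff_isPositive A).1 hA).conj_adjoint S)

lemma opSum_nonneg (hA : 0 ≤ A) (hC : 0 ≤ C) : 0 ≤ opSum A C := by
  rw [opSum_eq]
  exact add_nonneg (conj_comp_nonneg hA _) (conj_comp_nonneg hC _)

lemma opTrace_conj_isometry {H K : Type*} [NormedAddCommGroup H] [InnerProductSpace ℂ H]
    [CompleteSpace H] [NormedAddCommGroup K] [InnerProductSpace ℂ K] [CompleteSpace K]
    {A : H →L[ℂ] H} (hA : 0 ≤ A) {S : H →L[ℂ] K}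
    (hS : adjoint S ∘L S = 1) : opTrace (S ∘L A ∘L adjoint S) = opTrace A := by
  have h := opTrace_adjoint_comp_self (CFC.sqrt A ∘L adjoint S)
  have hs : adjoint (CFC.sqrt A) = CFC.sqrt A := sqrt_isSelfAdjoint A
  have hA' : CFC.sqrt A ∘L CFC.sqrt A = A := CFC.sqrt_mul_sqrt_self A hA
  rw [ContinuousLinearMap.adjoint_comp, ContinuousLinearMap.adjoint_adjoint, hs] at h
  calc _ = opTrace ((S ∘L CFC.sqrt A) ∘L (CFC.sqrt A ∘L adjoint S)) := by
        conv_lhs => rw [← hA']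
        simp only [ContinuousLinearMap.comp_assoc]
    _ = opTrace (CFC.sqrt A ∘L (adjoint S ∘L S) ∘L CFC.sqrt A) := by
        rw [h]
        simp only [ContinuousLinearMap.comp_assoc]
    _ = _ := by
        rw [hS]
        conv_rhs => rw [← hA']
        rfl

lemma opTrace_opSum (hA : 0 ≤ A) (hC : 0 ≤ C) :
    opTrace (opSum A C) = opTrace A + opTrace C := by
  rw [opSum_eq, opTrace_add (conj_comp_nonneg hA _) (conj_comp_nonneg hC _),
    opTrace_conj_isometry hA adjoint_sumInl_comp_sumInl,
    opTrace_conj_isometry hC adjoint_sumInr_comp_sumInr]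

lemma opTrace_opSum_rpow (A : H →L[ℂ] H) (C : K →L[ℂ] K) (r : ℝ) :
    opTrace (opSum (A ^ r) (C ^ r)) = opTrace (A ^ r) + opTrace (C ^ r) :=
  opTrace_opSum CFC.rpow_nonneg CFC.rpow_nonneg

lemma opSum_rpow (hA : 0 ≤ A) (hC : 0 ≤ C) {r : ℝ} (hr : 0 < r) :
    opSum A C ^ r = opSum (A ^ r) (C ^ r) := by
  have := eq_rpow_of_semigroup (g := fun q => opSum (A ^ q) (C ^ q))
    (fun q _ => opSum_nonneg CFC.rpow_nonneg CFC.rpow_nonneg)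
    (fun q s hq hs => by rw [opSum_mul, rpow_add_of_pos A hq hs, rpow_add_of_pos C hq hs])
    (by
      simp only [opSum_eq]
      exact (continuousOn_const.clm_comp ((continuousOn_rpow_exponent A).clm_comp
        continuousOn_const)).add (continuousOn_const.clm_comp
        ((continuousOn_rpow_exponent C).clm_comp continuousOn_const))) hr
  rw [this, CFC.rpow_one A hA, CFC.rpow_one C hC]

/-- Powers and products act blockwise. For α > 1 the infinite values must also match: block
sandwiches add up to a sandwich of the sum, and conversely a sandwich of the sum compresses to one
for each block. -/
lemma sandwichTrace_opSum (hα : 1 / 2 ≤ α) (hα1 : α ≠ 1) (hA : 0 ≤ A) (hB : 0 ≤ B) (hC : 0 ≤ C)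
    (hD : 0 ≤ D) : sandwichTrace α (opSum A C) (opSum B D)
      = sandwichTrace α A B + sandwichTrace α C D := by
  have h0 : 0 < α := by linarith
  rcases lt_or_gt_of_ne hα1 with h1 | h1
  · have hs := exponent_pos_of_lt_one hα h1
    have hX := conj_nonneg hA (rpow_isSelfAdjoint B ((1 - α) / (2 * α)))
    have hY := conj_nonneg hC (rpow_isSelfAdjoint D ((1 - α) / (2 * α)))
    rw [sandwichTrace_of_lt_one h1, sandwichTrace_of_lt_one h1, sandwichTrace_of_lt_one h1,
      opSum_rpow hB hD hs, opSum_mul, opSum_mul, opSum_rpow hX hY h0,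
      opTrace_opSum_rpow]
  · have ht := exponent_pos h1
    by_cases hex : (∃ X, IsSandwich α A B X) ∧ ∃ Y, IsSandwich α C D Y
    · obtain ⟨⟨X, hX⟩, Y, hY⟩ := hex
      rw [hX.sandwichTrace_eq h1 hB, hY.sandwichTrace_eq h1 hD]
      rw [isSandwich_iff_of_one_lt h1] at hX hY
      have hZ : IsSandwich α (opSum A C) (opSum B D) (opSum X Y) := by
        refine (isSandwich_iff_of_one_lt h1).2 ⟨opSum_nonneg hX.1 hY.1, fun z hz => ?_, ?_⟩
        · have h2 := congrArg WithLp.ofLp hz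
          rw [opSum_apply] at h2 ⊢
          rw [hX.2.1 _ (congrArg Prod.fst h2), hY.2.1 _ (congrArg Prod.snd h2)]
          rfl
        · rw [opSum_rpow hB hD ht, opSum_mul, opSum_mul, hX.2.2, hY.2.2]
      rw [hZ.sandwichTrace_eq h1 (opSum_nonneg hB hD), opSum_rpow hX.1 hY.1 h0,
        opTrace_opSum_rpow]
    · have htop : sandwichTrace α A B + sandwichTrace α C D = ∞ := by
        rw [not_and_or] at hex
        rcases hex with h | h <;> simp [sandwichTrace_eq_top h]
      rw [htop]
      refine sandwichTrace_eq_top fun ⟨Z, hZ⟩ => hex ?_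
      rw [isSandwich_iff_of_one_lt h1, opSum_rpow hB hD ht] at hZ
      obtain ⟨hZ0, hZd, hZe⟩ := hZ
      constructor
      · refine ⟨adjoint (sumInl H K) ∘L Z ∘L sumInl H K, (isSandwich_iff_of_one_lt h1).2
          ⟨?_, fun x hx => ?_, ?_⟩⟩
        · simpa using conj_comp_nonneg hZ0 (adjoint (sumInl H K))
        · have : opSum B D (sumInl H K x) = 0 := by
            rw [← ContinuousLinearMap.comp_apply, opSum_comp_sumInl,
              ContinuousLinearMap.comp_apply, hx, map_zero]
          rw [ContinuousLinearMap.comp_apply, ContinuousLinearMap.comp_apply, hZd _ this, map_zero]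
        · have h2 := congrArg (fun T => adjoint (sumInl H K) ∘L T ∘L sumInl H K) hZe
          simp only [ContinuousLinearMap.mul_def] at h2 ⊢
          rw [opSum_comp_sumInl, ← ContinuousLinearMap.comp_assoc _ (sumInl H K),
            adjoint_sumInl_comp_sumInl] at h2
          refine Eq.trans ?_ h2
          simp only [ContinuousLinearMap.comp_assoc, opSum_comp_sumInl]
          simp only [← ContinuousLinearMap.comp_assoc, adjoint_sumInl_comp_opSum]
      · refine ⟨adjoint (sumInr H K) ∘L Z ∘L sumInr H K, (isSandwich_iff_of_one_lt h1).2
          ⟨?_, fun x hx => ?_, ?_⟩⟩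
        · simpa using conj_comp_nonneg hZ0 (adjoint (sumInr H K))
        · have : opSum B D (sumInr H K x) = 0 := by
            rw [← ContinuousLinearMap.comp_apply, opSum_comp_sumInr,
              ContinuousLinearMap.comp_apply, hx, map_zero]
          rw [ContinuousLinearMap.comp_apply, ContinuousLinearMap.comp_apply, hZd _ this, map_zero]
        · have h2 := congrArg (fun T => adjoint (sumInr H K) ∘L T ∘L sumInr H K) hZe
          simp only [ContinuousLinearMap.mul_def] at h2 ⊢
          rw [opSum_comp_sumInr, ← ContinuousLinearMap.comp_assoc _ (sumInr H K),
            adjoint_sumInr_comp_sumInr] at h2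
          refine Eq.trans ?_ h2
          simp only [ContinuousLinearMap.comp_assoc, opSum_comp_sumInr]
          simp only [← ContinuousLinearMap.comp_assoc, adjoint_sumInr_comp_opSum]

/-- The divergence is by definition g⁻¹ of the trace quotient, so g recovers a quantity that is
additive up to the weights tr A and tr C. -/
lemma expMean_regRenyiDiv (hα1 : α ≠ 1) (lam : ℝ) (A B : H →L[ℂ] H) :
    expMean α (regRenyiDiv α lam A B)
      = sandwichTrace α A (B + (lam : ℂ) • (1 : H →L[ℂ] H)) / opTrace A :=
  expMean_expMeanInv hα1 _

lemma regRenyiDiv_opSum (hα : 1 / 2 ≤ α) (hα1 : α ≠ 1) {lam : ℝ} (hl : 0 ≤ lam)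
    (hA : IsPosTraceClass A) (hB : 0 ≤ B) (hC : IsPosTraceClass C) (hD : 0 ≤ D) :
    regRenyiDiv α lam (opSum A C) (opSum B D) = expMeanInv α
      (opTrace A / (opTrace A + opTrace C) * expMean α (regRenyiDiv α lam A B)
        + opTrace C / (opTrace A + opTrace C) * expMean α (regRenyiDiv α lam C D)) := by
  have e : ∀ {t a q : ℝ≥0∞}, a ≠ 0 → a ≠ ∞ → a / t * (q / a) = q / t := fun {t a q} h0 h1 => by
    rw [mul_comm, ← mul_div_assoc, ENNReal.div_mul_cancel h0 h1]
  rw [expMean_regRenyiDiv hα1, expMean_regRenyiDiv hα1, e hA.opTrace_ne_zero hA.2.2.ne, e hC.opTrace_ne_zero hC.2.2.ne, ENNReal.div_add_div_same,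
    ← sandwichTrace_opSum hα hα1 hA.1 (add_smul_one_nonneg hB hl) hC.1 (add_smul_one_nonneg hD hl),
    opSum_add_smul_one, ← opTrace_opSum hA.1 hC.1]
  rfl

end DirectSum

/-! ### Tensor products and the two additivity inequalities. -/

section Tensor

variable {H : Type*} [NormedAddCommGroup H] [InnerProductSpace ℂ H] [CompleteSpace H]
variable {K : Type*} [NormedAddCommGroup K] [InnerProductSpace ℂ K] [CompleteSpace K]

variable {α : ℝ} {A B : H →L[ℂ] H} {C D : K →L[ℂ] K}

open ContinuousLinearMap (adjoint)

/-! ### Tensor products -/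

variable (H) in
/-- The real powers of operators given by the continuous functional calculus. -/
abbrev opPow : Pow (H →L[ℂ] H) ℝ := inferInstance

/-- A shortcut: instance search does not unfold `HTensor` far enough. -/
instance : Pow (HTensor H K →L[ℂ] HTensor H K) ℝ := opPow _

variable (H) in
/-- The bounded operator `x ↦ x ⊗ y`. -/
def tensorRight (y : K) : H →L[ℂ] HTensor H K :=
  (UniformSpace.Completion.toComplL : H ⊗[ℂ] K →L[ℂ] HTensor H K) ∘L
    ((TensorProduct.mk ℂ H K).flip y).mkContinuous ‖y‖ fun x => by
      rw [LinearMap.flip_apply, TensorProduct.mk_apply, TensorProduct.norm_tmul, mul_comm]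

variable (K) in
/-- The bounded operator `y ↦ x ⊗ y`. -/
def tensorLeft (x : H) : K →L[ℂ] HTensor H K :=
  (UniformSpace.Completion.toComplL : H ⊗[ℂ] K →L[ℂ] HTensor H K) ∘L
    (TensorProduct.mk ℂ H K x).mkContinuous ‖x‖ fun y => by
      rw [TensorProduct.mk_apply, TensorProduct.norm_tmul]

lemma tensorRight_apply (x : H) (y : K) :
    tensorRight H y x = ((x ⊗ₜ[ℂ] y : H ⊗[ℂ] K) : HTensor H K) := rfl

lemma tensorLeft_apply (x : H) (y : K) :
    tensorLeft K x y = ((x ⊗ₜ[ℂ] y : H ⊗[ℂ] K) : HTensor H K) := rfl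

lemma opTensor_tensorRight (A : H →L[ℂ] H) (C : K →L[ℂ] K) (x : H) (y : K) :
    opTensor A C (tensorRight H y x) = tensorRight H (C y) (A x) :=
  opTensor_coe_tmul A C x y

lemma opTensor_tensorLeft (A : H →L[ℂ] H) (C : K →L[ℂ] K) (x : H) (y : K) :
    opTensor A C (tensorLeft K x y) = tensorLeft K (A x) (C y) :=
  opTensor_coe_tmul A C x y

lemma inner_tensorRight (x x' : H) (y y' : K) :
    ⟪tensorRight H y x, tensorRight H y' x'⟫_ℂ = ⟪x, x'⟫_ℂ * ⟪y, y'⟫_ℂ := by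
  rw [tensorRight_apply, tensorRight_apply, UniformSpace.Completion.inner_coe,
    TensorProduct.inner_tmul]

lemma tensor_ext {E : Type*} [NormedAddCommGroup E] [NormedSpace ℂ E] {S T : HTensor H K →L[ℂ] E}
    (h : ∀ x y, S (tensorRight H y x) = T (tensorRight H y x)) : S = T := by
  ext z
  refine UniformSpace.Completion.induction_on z (isClosed_eq S.continuous T.continuous) fun w => ?_
  induction w using TensorProduct.induction_on with
  | zero => rw [UniformSpace.Completion.coe_zero, map_zero, map_zero]
  | add w₁ w₂ h₁ h₂ => rw [UniformSpace.Completion.coe_add, map_add, map_add, h₁, h₂]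
  | tmul x y => exact h x y

lemma eq_zero_of_inner_tensorRight {z : HTensor H K}
    (h : ∀ x y, ⟪tensorRight H y x, z⟫_ℂ = 0) : z = 0 := by
  have : innerSL ℂ z = 0 := tensor_ext fun x y => by
    rw [innerSL_apply_apply, ← inner_conj_symm, h, map_zero, zero_apply]
  rw [← inner_self_eq_zero (𝕜 := ℂ), ← innerSL_apply_apply ℂ, this, zero_apply]

lemma opTensor_mul (A A' : H →L[ℂ] H) (C C' : K →L[ℂ] K) :
    opTensor A C * opTensor A' C' = opTensor (A * A') (C * C') :=
  tensor_ext fun x y => by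
    simp only [mul_apply_eq_comp, opTensor_tensorRight]

lemma opTensor_add_left (A A' : H →L[ℂ] H) (C : K →L[ℂ] K) :
    opTensor (A + A') C = opTensor A C + opTensor A' C :=
  tensor_ext fun x y => by
    simp only [add_apply, opTensor_tensorRight, map_add]

lemma opTensor_add_right (A : H →L[ℂ] H) (C C' : K →L[ℂ] K) :
    opTensor A (C + C') = opTensor A C + opTensor A C' :=
  tensor_ext fun x y => by
    change opTensor A (C + C') (tensorLeft K x y)
      = opTensor A C (tensorLeft K x y) + opTensor A C' (tensorLeft K x y)
    simp only [add_apply, opTensor_tensorLeft, map_add]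

lemma opTensor_smul_left (c : ℂ) (A : H →L[ℂ] H) (C : K →L[ℂ] K) :
    opTensor (c • A) C = c • opTensor A C :=
  tensor_ext fun x y => by
    simp only [smul_apply, opTensor_tensorRight, map_smul]

lemma opTensor_smul_right (c : ℂ) (A : H →L[ℂ] H) (C : K →L[ℂ] K) :
    opTensor A (c • C) = c • opTensor A C :=
  tensor_ext fun x y => by
    change opTensor A (c • C) (tensorLeft K x y) = c • opTensor A C (tensorLeft K x y)
    simp only [smul_apply, opTensor_tensorLeft, map_smul]

lemma opTensor_one_one : opTensor (1 : H →L[ℂ] H) (1 : K →L[ℂ] K) = 1 :=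
  tensor_ext fun x y => by
    simp only [one_apply_eq_self, opTensor_tensorRight]

lemma star_opTensor (A : H →L[ℂ] H) (C : K →L[ℂ] K) :
    star (opTensor A C) = opTensor (star A) (star C) := by
  refine tensor_ext fun x y => ?_
  rw [← sub_eq_zero]
  refine eq_zero_of_inner_tensorRight fun x' y' => ?_
  rw [inner_sub_right, ContinuousLinearMap.star_eq_adjoint,
    ContinuousLinearMap.adjoint_inner_right, opTensor_tensorRight, opTensor_tensorRight,
    inner_tensorRight, inner_tensorRight, ContinuousLinearMap.star_eq_adjoint,
    ContinuousLinearMap.star_eq_adjoint, ContinuousLinearMap.adjoint_inner_right,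
    ContinuousLinearMap.adjoint_inner_right, sub_self]

lemma opTensor_nonneg (hA : 0 ≤ A) (hC : 0 ≤ C) : 0 ≤ opTensor A C := by
  have h := star_mul_self_nonneg (opTensor (CFC.sqrt A) (CFC.sqrt C))
  rwa [star_opTensor, (sqrt_isSelfAdjoint A).star_eq, (sqrt_isSelfAdjoint C).star_eq,
    opTensor_mul, CFC.sqrt_mul_sqrt_self A hA, CFC.sqrt_mul_sqrt_self C hC] at h

lemma norm_opTensor_le (A : H →L[ℂ] H) (C : K →L[ℂ] K) : ‖opTensor A C‖ ≤ ‖A‖ * ‖C‖ := by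
  refine ContinuousLinearMap.opNorm_le_bound _ (by positivity) fun z => ?_
  refine UniformSpace.Completion.induction_on z (isClosed_le (by fun_prop) (by fun_prop)) fun w => ?_
  have hw : opTensor A C (w : HTensor H K)
      = ((TensorProduct.map (A : H →ₗ[ℂ] H) (C : K →ₗ[ℂ] K) w : H ⊗[ℂ] K) : HTensor H K) := by
    induction w using TensorProduct.induction_on with
    | zero => rw [map_zero, UniformSpace.Completion.coe_zero, map_zero]
    | add w₁ w₂ h₁ h₂ =>
      rw [map_add, UniformSpace.Completion.coe_add, map_add, UniformSpace.Completion.coe_add, h₁, h₂]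
    | tmul x y => exact opTensor_coe_tmul A C x y
  rw [hw, UniformSpace.Completion.norm_coe, UniformSpace.Completion.norm_coe]
  exact norm_map_le A C w

lemma continuous_opTensor_one_right :
    Continuous fun A : H →L[ℂ] H => opTensor A (1 : K →L[ℂ] K) := by
  have h : LipschitzWith ‖(1 : K →L[ℂ] K)‖₊
      fun A : H →L[ℂ] H => opTensor A (1 : K →L[ℂ] K) := by
    refine LipschitzWith.of_dist_le_mul fun A A' => ?_
    have e : opTensor A (1 : K →L[ℂ] K) - opTensor A' 1 = opTensor (A - A') 1 := by
      rw [sub_eq_iff_eq_add, ← opTensor_add_left, sub_add_cancel]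
    rw [dist_eq_norm, dist_eq_norm, e, coe_nnnorm, mul_comm]
    exact norm_opTensor_le _ _
  exact h.continuous

lemma continuous_opTensor_one_left :
    Continuous fun C : K →L[ℂ] K => opTensor (1 : H →L[ℂ] H) C := by
  have h : LipschitzWith ‖(1 : H →L[ℂ] H)‖₊
      fun C : K →L[ℂ] K => opTensor (1 : H →L[ℂ] H) C := by
    refine LipschitzWith.of_dist_le_mul fun C C' => ?_
    have e : opTensor (1 : H →L[ℂ] H) C - opTensor 1 C' = opTensor 1 (C - C') := by
      rw [sub_eq_iff_eq_add, ← opTensor_add_right, sub_add_cancel]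
    rw [dist_eq_norm, dist_eq_norm, e, coe_nnnorm]
    exact norm_opTensor_le _ _
  exact h.continuous

lemma opTensor_rpow (hA : 0 ≤ A) (hC : 0 ≤ C) {r : ℝ} (hr : 0 < r) :
    opTensor A C ^ r = opTensor (A ^ r) (C ^ r) := by
  have := eq_rpow_of_semigroup (g := fun q => opTensor (A ^ q) (C ^ q))
    (fun q _ => opTensor_nonneg CFC.rpow_nonneg CFC.rpow_nonneg)
    (fun q s hq hs => by rw [opTensor_mul, rpow_add_of_pos A hq hs, rpow_add_of_pos C hq hs])
    (by
      -- Splitting into two factors, each depending on one operator only, reduces continuity to the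
      -- two one-variable Lipschitz bounds.
      have h : ∀ q : ℝ, opTensor (A ^ q) (C ^ q) = opTensor (A ^ q) 1 ∘L opTensor 1 (C ^ q) :=
        fun q => by rw [← ContinuousLinearMap.mul_def, opTensor_mul, mul_one, one_mul]
      simp only [h]
      exact (continuous_opTensor_one_right.comp_continuousOn (continuousOn_rpow_exponent A)).clm_comp
        (continuous_opTensor_one_left.comp_continuousOn (continuousOn_rpow_exponent C))) hr
  rw [this, CFC.rpow_one A hA, CFC.rpow_one C hC]

lemma eq_zero_of_inner_hilbertBasis {ι : Type*} (b : HilbertBasis ι ℂ H) {x : H}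
    (h : ∀ i, ⟪b i, x⟫_ℂ = 0) : x = 0 := by
  have hp := parseval_ennreal b x
  simp only [h, norm_zero] at hp
  simpa using hp.symm

/-- The Hilbert basis of a tensor product made of the tensors of basis vectors. -/
def tensorHilbertBasis {ι κ : Type*} (b : HilbertBasis ι ℂ H) (c : HilbertBasis κ ℂ K) :
    HilbertBasis (ι × κ) ℂ (HTensor H K) :=
  HilbertBasis.mkOfOrthogonalEqBot (v := fun i : ι × κ => tensorRight H (c i.2) (b i.1))
    ((b.orthonormal.tmul c.orthonormal).comp_linearIsometry
      (UniformSpace.Completion.toComplₗᵢ : H ⊗[ℂ] K →ₗᵢ[ℂ] HTensor H K)) (by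
    -- Totality is proved one factor at a time: the slices of z along the c j vanish by completeness
    -- of b, and then those along arbitrary x vanish by completeness of c.
    refine (Submodule.eq_bot_iff _).2 fun z hz => ?_
    have h1 : ∀ i j, ⟪tensorRight H (c j) (b i), z⟫_ℂ = 0 := fun i j =>
      hz _ (Submodule.subset_span ⟨(i, j), rfl⟩)
    have h2 : ∀ j, adjoint (tensorRight H (c j)) z = 0 := fun j =>
      eq_zero_of_inner_hilbertBasis b fun i => by rw [ContinuousLinearMap.adjoint_inner_right, h1]
    have h3 : ∀ x, adjoint (tensorLeft K x) z = 0 := fun x =>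
      eq_zero_of_inner_hilbertBasis c fun j => by
        rw [ContinuousLinearMap.adjoint_inner_right, tensorLeft_apply, ← tensorRight_apply,
          ← ContinuousLinearMap.adjoint_inner_right, h2, inner_zero_right]
    refine eq_zero_of_inner_tensorRight fun x y => ?_
    rw [tensorRight_apply, ← tensorLeft_apply, ← ContinuousLinearMap.adjoint_inner_right, h3,
      inner_zero_right])

lemma tensorHilbertBasis_apply {ι κ : Type*} (b : HilbertBasis ι ℂ H) (c : HilbertBasis κ ℂ K)
    (i : ι × κ) : tensorHilbertBasis b c i = tensorRight H (c i.2) (b i.1) := by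
  exact congrFun (HilbertBasis.coe_mkOfOrthogonalEqBot _ _) i

lemma coe_re_inner {T : H →L[ℂ] H} (hT : 0 ≤ T) (x : H) :
    ((RCLike.re ⟪x, T x⟫_ℂ : ℝ) : ℂ) = ⟪x, T x⟫_ℂ := by
  have h := (inner_apply_of_isSelfAdjoint hT.isSelfAdjoint x x)
  exact RCLike.conj_eq_iff_re.1 (by rw [inner_conj_symm, h])

/-- In the product basis the diagonal entries are products of real nonnegative numbers, so the
double sum factors. -/
lemma opTrace_opTensor (hA : 0 ≤ A) (hC : 0 ≤ C) :
    opTrace (opTensor A C) = opTrace A * opTrace C := by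
  obtain ⟨b, -⟩ := (exists_hilbertBasis ℂ H).choose_spec
  obtain ⟨c, -⟩ := (exists_hilbertBasis ℂ K).choose_spec
  rw [opTrace_eq_tsum (tensorHilbertBasis b c) (opTensor_nonneg hA hC), opTrace_eq_tsum b hA,
    opTrace_eq_tsum c hC, ENNReal.tsum_prod', ← ENNReal.tsum_mul_right]
  refine tsum_congr fun i => ?_
  rw [← ENNReal.tsum_mul_left]
  refine tsum_congr fun j => ?_
  rw [tensorHilbertBasis_apply, opTensor_tensorRight, inner_tensorRight,
    ← ENNReal.ofReal_mul (re_inner_nonneg hA _), ← coe_re_inner hA, ← coe_re_inner hC,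
    ← Complex.ofReal_mul]
  simp

/-- The slice map adjoint to x ↦ x ⊗ y intertwines T ⊗ 1 with T. Every slice of z thus lies in ker
B, and slices determine vectors. -/
lemma Dominates.opTensor_left {X : H →L[ℂ] H} (hB : IsSelfAdjoint B) (hX : IsSelfAdjoint X)
    (h : Dominates B X) : Dominates (opTensor B (1 : K →L[ℂ] K)) (opTensor X 1) := by
  intro z hz
  have key : ∀ T : H →L[ℂ] H, IsSelfAdjoint T → ∀ y : K,
      adjoint (tensorRight H y) (opTensor T 1 z) = T (adjoint (tensorRight H y) z) := by
    intro T hT y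
    have hs : IsSelfAdjoint (opTensor T (1 : K →L[ℂ] K)) := by
      rw [isSelfAdjoint_iff, star_opTensor, hT.star_eq, star_one]
    refine ext_inner_left ℂ fun x => ?_
    rw [ContinuousLinearMap.adjoint_inner_right, ← inner_apply_of_isSelfAdjoint hs,
      opTensor_tensorRight, one_apply_eq_self, ← inner_apply_of_isSelfAdjoint hT,
      ContinuousLinearMap.adjoint_inner_right]
  refine eq_zero_of_inner_tensorRight fun x y => ?_
  have h1 := key B hB y
  rw [hz, map_zero] at h1
  rw [← ContinuousLinearMap.adjoint_inner_right, key X hX, h _ h1.symm, inner_zero_right]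

lemma Dominates.opTensor_right {Y : K →L[ℂ] K} (hD : IsSelfAdjoint D) (hY : IsSelfAdjoint Y)
    (h : Dominates D Y) : Dominates (opTensor (1 : H →L[ℂ] H) D) (opTensor 1 Y) := by
  intro z hz
  have key : ∀ T : K →L[ℂ] K, IsSelfAdjoint T → ∀ x : H,
      adjoint (tensorLeft K x) (opTensor 1 T z) = T (adjoint (tensorLeft K x) z) := by
    intro T hT x
    have hs : IsSelfAdjoint (opTensor (1 : H →L[ℂ] H) T) := by
      rw [isSelfAdjoint_iff, star_opTensor, hT.star_eq, star_one]
    refine ext_inner_left ℂ fun y => ?_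
    rw [ContinuousLinearMap.adjoint_inner_right, ← inner_apply_of_isSelfAdjoint hs,
      opTensor_tensorLeft, one_apply_eq_self, ← inner_apply_of_isSelfAdjoint hT,
      ContinuousLinearMap.adjoint_inner_right]
  refine eq_zero_of_inner_tensorRight fun x y => ?_
  have h1 := key D hD x
  rw [hz, map_zero] at h1
  rw [tensorRight_apply, ← tensorLeft_apply, ← ContinuousLinearMap.adjoint_inner_right, key Y hY,
    h _ h1.symm, inner_zero_right]

/-- Factor B ⊗ D = (B ⊗ 1)(1 ⊗ D), replace B by X, commute the two factors, and then replace D by Y.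
-/
lemma Dominates.opTensor {X : H →L[ℂ] H} {Y : K →L[ℂ] K} (hB : IsSelfAdjoint B)
    (hX : IsSelfAdjoint X) (hD : IsSelfAdjoint D) (hY : IsSelfAdjoint Y) (hBX : Dominates B X)
    (hDY : Dominates D Y) : Dominates (opTensor B D) (opTensor X Y) := by
  intro z hz
  have e : ∀ (S : H →L[ℂ] H) (T : K →L[ℂ] K) (w : HTensor H K),
      QRenyi.opTensor S T w = QRenyi.opTensor S 1 (QRenyi.opTensor 1 T w) := fun S T w => by
    rw [← mul_apply_eq_comp, opTensor_mul, mul_one, one_mul]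
  have e' : ∀ (S : H →L[ℂ] H) (T : K →L[ℂ] K) (w : HTensor H K),
      QRenyi.opTensor S T w = QRenyi.opTensor 1 T (QRenyi.opTensor S 1 w) := fun S T w => by
    rw [← mul_apply_eq_comp, opTensor_mul, mul_one, one_mul]
  rw [e] at hz
  have h1 := hBX.opTensor_left hB hX _ hz
  rw [← e, e'] at h1
  have h2 := hDY.opTensor_right hD hY _ h1
  rwa [← e'] at h2

lemma exists_re_inner_pos (hC : 0 ≤ C) (hC0 : C ≠ 0) : ∃ y, 0 < RCLike.re ⟪y, C y⟫_ℂ := by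
  by_contra! h
  refine hC0 ?_
  have : CFC.sqrt C = 0 := by
    ext y
    have := h y
    rw [re_inner_eq_norm_sqrt hC] at this
    simpa using le_antisymm this (by positivity)
  rw [← CFC.sqrt_mul_sqrt_self C hC, this, mul_zero]

lemma smul_nonneg_of_real {T : H →L[ℂ] H} (hT : 0 ≤ T) {c : ℝ} (hc : 0 ≤ c) :
    0 ≤ (c : ℂ) • T := by
  have : (c : ℂ) • T = c • T := by ext; simp
  rw [this]
  exact smul_nonneg hc hT

/-- Choose y with k = ⟪y, C y⟫ > 0 and compress Z along V x = x ⊗ D ^ t y. Then B ^ t (V* Z V) B ^ t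
= k A, so V* Z V / k is the sandwich. This shows that an infinite factor makes the tensor trace
infinite. -/
lemma exists_isSandwich_of_opTensor_left (hα : 1 < α) (hC : 0 ≤ C) (hC0 : C ≠ 0) (hB : 0 ≤ B)
    (hD : 0 ≤ D) (h : ∃ Z, IsSandwich α (opTensor A C) (opTensor B D) Z) :
    ∃ X, IsSandwich α A B X := by
  obtain ⟨Z, hZ⟩ := h
  have ht := exponent_pos hα
  rw [isSandwich_iff_of_one_lt hα, opTensor_rpow hB hD ht] at hZ
  obtain ⟨hZ0, hZd, hZe⟩ := hZ
  obtain ⟨y, hy⟩ := exists_re_inner_pos hC hC0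
  set t := (α - 1) / (2 * α) with htdef
  set k := RCLike.re ⟪y, C y⟫_ℂ with hk
  set V := tensorRight H ((D ^ t) y) with hV
  refine ⟨((k⁻¹ : ℝ) : ℂ) • (adjoint V ∘L Z ∘L V), (isSandwich_iff_of_one_lt hα).2
    ⟨smul_nonneg_of_real ?_ (by positivity), fun x hx => ?_, ?_⟩⟩
  · simpa using conj_comp_nonneg hZ0 (adjoint V)
  · have : opTensor B D (V x) = 0 := by
      rw [hV, opTensor_tensorRight, hx, map_zero]
    rw [smul_apply, ContinuousLinearMap.comp_apply, ContinuousLinearMap.comp_apply, hZd _ this,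
      map_zero, smul_zero]
  · ext x
    refine ext_inner_left ℂ fun x' => ?_
    have h1 := congrArg (fun T => ⟪tensorRight H y x', T (tensorRight H y x)⟫_ℂ) hZe
    have hs : IsSelfAdjoint (opTensor (B ^ t) (D ^ t)) := by
      rw [isSelfAdjoint_iff, star_opTensor, (rpow_isSelfAdjoint B t).star_eq,
        (rpow_isSelfAdjoint D t).star_eq]
    simp only [mul_apply_eq_comp, opTensor_tensorRight, inner_tensorRight] at h1
    rw [← inner_apply_of_isSelfAdjoint hs, opTensor_tensorRight, ← coe_re_inner hC, ← hk] at h1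
    rw [mul_apply_eq_comp, mul_apply_eq_comp, ← inner_apply_of_isSelfAdjoint (rpow_isSelfAdjoint B t),
      smul_apply, inner_smul_right, ContinuousLinearMap.comp_apply, ContinuousLinearMap.comp_apply,
      ContinuousLinearMap.adjoint_inner_right, hV, h1, Complex.ofReal_inv, mul_comm,
      mul_assoc, mul_inv_cancel₀ (by exact_mod_cast hy.ne'), mul_one]

lemma exists_isSandwich_of_opTensor_right (hα : 1 < α) (hA : 0 ≤ A) (hA0 : A ≠ 0) (hB : 0 ≤ B)
    (hD : 0 ≤ D) (h : ∃ Z, IsSandwich α (opTensor A C) (opTensor B D) Z) :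
    ∃ Y, IsSandwich α C D Y := by
  obtain ⟨Z, hZ⟩ := h
  have ht := exponent_pos hα
  rw [isSandwich_iff_of_one_lt hα, opTensor_rpow hB hD ht] at hZ
  obtain ⟨hZ0, hZd, hZe⟩ := hZ
  obtain ⟨x, hx⟩ := exists_re_inner_pos hA hA0
  set t := (α - 1) / (2 * α) with htdef
  set k := RCLike.re ⟪x, A x⟫_ℂ with hk
  set V := tensorLeft K ((B ^ t) x) with hV
  refine ⟨((k⁻¹ : ℝ) : ℂ) • (adjoint V ∘L Z ∘L V), (isSandwich_iff_of_one_lt hα).2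
    ⟨smul_nonneg_of_real ?_ (by positivity), fun y hy => ?_, ?_⟩⟩
  · simpa using conj_comp_nonneg hZ0 (adjoint V)
  · have : opTensor B D (V y) = 0 := by
      rw [hV, opTensor_tensorLeft, hy, map_zero]
    rw [smul_apply, ContinuousLinearMap.comp_apply, ContinuousLinearMap.comp_apply, hZd _ this,
      map_zero, smul_zero]
  · ext y
    refine ext_inner_left ℂ fun y' => ?_
    have h1 := congrArg (fun T => ⟪tensorLeft K x y', T (tensorLeft K x y)⟫_ℂ) hZe
    have hs : IsSelfAdjoint (opTensor (B ^ t) (D ^ t)) := by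
      rw [isSelfAdjoint_iff, star_opTensor, (rpow_isSelfAdjoint B t).star_eq,
        (rpow_isSelfAdjoint D t).star_eq]
    have hi : ∀ (u u' : H) (v v' : K),
      ⟪tensorLeft K u v, tensorLeft K u' v'⟫_ℂ = ⟪u, u'⟫_ℂ * ⟪v, v'⟫_ℂ :=
        fun u u' v v' => inner_tensorRight u u' v v'
    simp only [mul_apply_eq_comp, opTensor_tensorLeft, hi] at h1
    rw [← inner_apply_of_isSelfAdjoint hs, opTensor_tensorLeft, ← coe_re_inner hA, ← hk] at h1
    rw [mul_apply_eq_comp, mul_apply_eq_comp, ← inner_apply_of_isSelfAdjoint (rpow_isSelfAdjoint D t),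
      smul_apply, inner_smul_right, ContinuousLinearMap.comp_apply, ContinuousLinearMap.comp_apply,
      ContinuousLinearMap.adjoint_inner_right, hV, h1, Complex.ofReal_inv,
      inv_mul_cancel_left₀ (by exact_mod_cast hx.ne')]

lemma opTrace_opTensor_rpow (A : H →L[ℂ] H) (C : K →L[ℂ] K) (r : ℝ) :
    opTrace (opTensor (A ^ r) (C ^ r)) = opTrace (A ^ r) * opTrace (C ^ r) :=
  opTrace_opTensor CFC.rpow_nonneg CFC.rpow_nonneg

lemma sandwichTrace_opTensor (hα : 1 / 2 ≤ α) (hα1 : α ≠ 1) (hA : 0 ≤ A) (hA0 : A ≠ 0)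
    (hB : 0 ≤ B) (hC : 0 ≤ C) (hC0 : C ≠ 0) (hD : 0 ≤ D) (hBA : Dominates B A)
    (hDC : Dominates D C) : sandwichTrace α (opTensor A C) (opTensor B D)
      = sandwichTrace α A B * sandwichTrace α C D := by
  have h0 : 0 < α := by linarith
  rcases lt_or_gt_of_ne hα1 with h1 | h1
  · have hs := exponent_pos_of_lt_one hα h1
    have hX := conj_nonneg hA (rpow_isSelfAdjoint B ((1 - α) / (2 * α)))
    have hY := conj_nonneg hC (rpow_isSelfAdjoint D ((1 - α) / (2 * α)))
    rw [sandwichTrace_of_lt_one h1, sandwichTrace_of_lt_one h1, sandwichTrace_of_lt_one h1,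
      opTensor_rpow hB hD hs, opTensor_mul, opTensor_mul, opTensor_rpow hX hY h0,
      opTrace_opTensor_rpow]
  · have ht := exponent_pos h1
    by_cases hex : (∃ X, IsSandwich α A B X) ∧ ∃ Y, IsSandwich α C D Y
    · obtain ⟨⟨X, hX⟩, Y, hY⟩ := hex
      rw [hX.sandwichTrace_eq h1 hB, hY.sandwichTrace_eq h1 hD]
      rw [isSandwich_iff_of_one_lt h1] at hX hY
      have hZ : IsSandwich α (opTensor A C) (opTensor B D) (opTensor X Y) := by
        refine (isSandwich_iff_of_one_lt h1).2 ⟨opTensor_nonneg hX.1 hY.1, ?_, ?_⟩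
        · exact Dominates.opTensor hB.isSelfAdjoint hX.1.isSelfAdjoint hD.isSelfAdjoint
            hY.1.isSelfAdjoint hX.2.1 hY.2.1
        · rw [opTensor_rpow hB hD ht, opTensor_mul, opTensor_mul, hX.2.2, hY.2.2]
      rw [hZ.sandwichTrace_eq h1 (opTensor_nonneg hB hD), opTensor_rpow hX.1 hY.1 h0,
        opTrace_opTensor_rpow]
    -- One factor is ∞ and the other is nonzero, so the product is ∞.
    · have htop : sandwichTrace α A B * sandwichTrace α C D = ∞ := by
        rw [not_and_or] at hex
        rcases hex with h | h
        · rw [sandwichTrace_eq_top h, ENNReal.top_mul (sandwichTrace_ne_zero hα hα1 hC hC0 hD hDC)]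
        · rw [sandwichTrace_eq_top h, ENNReal.mul_top (sandwichTrace_ne_zero hα hα1 hA hA0 hB hBA)]
      rw [htop]
      exact sandwichTrace_eq_top fun h => hex
        ⟨exists_isSandwich_of_opTensor_left h1 hC hC0 hB hD h,
          exists_isSandwich_of_opTensor_right h1 hA hA0 hB hD h⟩

/-! ### Additivity -/

/-- As ⊤ + ⊥ = ⊥ in `EReal`, distributivity fails for c < 0 at that pair. Logarithms of nonzero
quotients are never ⊥. -/
lemma coe_mul_add_of_ne_bot (c : ℝ) {a b : EReal} (ha : a ≠ ⊥) (hb : b ≠ ⊥) :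
    (c : EReal) * (a + b) = c * a + c * b := by
  induction a with
  | bot => exact absurd rfl ha
  | coe a =>
    induction b with
    | bot => exact absurd rfl hb
    | coe b => norm_cast; ring
    | top =>
      rw [EReal.coe_add_top]
      rcases lt_trichotomy c 0 with h | rfl | h
      · rw [EReal.coe_mul_top_of_neg h, EReal.add_bot]
      · simp
      · rw [EReal.coe_mul_top_of_pos h, ← EReal.coe_mul, EReal.coe_add_top]
  | top =>
    rw [EReal.top_add_of_ne_bot hb]
    rcases lt_trichotomy c 0 with h | rfl | h
    · rw [EReal.coe_mul_top_of_neg h, EReal.bot_add]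
    · simp
    · rw [EReal.coe_mul_top_of_pos h, EReal.top_add_of_ne_bot]
      induction b with
      | bot => exact absurd rfl hb
      | coe b => exact_mod_cast EReal.coe_ne_bot _
      | top => rw [EReal.coe_mul_top_of_pos h]; exact top_ne_bot

lemma renyiDiv_opTensor (hα : 1 / 2 ≤ α) (hα1 : α ≠ 1) (hA : IsPosTraceClass A) (hB : 0 ≤ B)
    (hC : IsPosTraceClass C) (hD : 0 ≤ D) (hBA : Dominates B A) (hDC : Dominates D C) :
    renyiDiv α (opTensor A C) (opTensor B D) = renyiDiv α A B + renyiDiv α C D := by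
  have hne : ∀ {q t : ℝ≥0∞}, q ≠ 0 → t ≠ ∞ → ENNReal.log (q / t) ≠ ⊥ := fun {q t} hq ht => by
    rw [ne_eq, ENNReal.log_eq_bot_iff, ENNReal.div_eq_zero_iff, not_or]
    exact ⟨hq, ht⟩
  rw [renyiDiv, renyiDiv, renyiDiv,
    sandwichTrace_opTensor hα hα1 hA.1 hA.2.1 hB hC.1 hC.2.1 hD hBA hDC,
    opTrace_opTensor hA.1 hC.1, ← coe_mul_add_of_ne_bot _
      (hne (sandwichTrace_ne_zero hα hα1 hA.1 hA.2.1 hB hBA) hA.2.2.ne)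
      (hne (sandwichTrace_ne_zero hα hα1 hC.1 hC.2.1 hD hDC) hC.2.2.ne), ← ENNReal.log_mul_add,
    ENNReal.mul_div_mul_comm (Or.inl hA.opTrace_ne_zero) (Or.inl hA.2.2.ne)]

lemma Dominates.add_smul_one (hB : 0 ≤ B) (hBA : Dominates B A) {lam : ℝ} (hl : 0 ≤ lam) :
    Dominates (B + (lam : ℂ) • (1 : H →L[ℂ] H)) A := by
  rcases hl.eq_or_lt with rfl | hl
  · simpa using hBA
  · intro x hx
    have h1 := congrArg (fun v => RCLike.re ⟪x, v⟫_ℂ) hx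
    have h2 := re_inner_nonneg hB x
    simp only [add_apply, smul_apply, one_apply_eq_self, inner_add_right, inner_smul_right, map_add,
      inner_zero_right, map_zero, RCLike.re_eq_complex_re, Complex.re_ofReal_mul] at h1 h2
    have h3 := inner_self_eq_norm_sq (𝕜 := ℂ) x
    rw [RCLike.re_eq_complex_re] at h3
    rw [h3] at h1
    have h4 : ‖x‖ ^ 2 = 0 := by
      have : 0 ≤ lam * ‖x‖ ^ 2 := by positivity
      have h5 : lam * ‖x‖ ^ 2 = 0 := by linarith
      exact (mul_eq_zero.1 h5).resolve_left hl.ne'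
    rw [norm_eq_zero.1 (pow_eq_zero_iff two_ne_zero |>.1 h4), map_zero]

lemma opTensor_add_smul_one (B : H →L[ℂ] H) (D : K →L[ℂ] K) (c : ℂ) :
    opTensor (B + c • 1) (D + c • 1)
      = opTensor B D + c • (opTensor B 1 + opTensor 1 D) + (c * c) • 1 := by
  rw [opTensor_add_left, opTensor_add_right, opTensor_add_right, opTensor_smul_left,
    opTensor_smul_left, opTensor_smul_right, opTensor_smul_right, opTensor_one_one, smul_smul,
    smul_add]
  abel

/-- (B + √λ) ⊗ (D + √λ) exceeds B ⊗ D + λ by √λ (B ⊗ 1 + 1 ⊗ D) ≥ 0, and the divergence is antitone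
in its second argument. -/
lemma add_le_regRenyiDiv_opTensor (hα : 1 / 2 ≤ α) (hα1 : α ≠ 1) {lam : ℝ} (hl : 0 ≤ lam)
    (hA : IsPosTraceClass A) (hB : 0 ≤ B) (hC : IsPosTraceClass C) (hD : 0 ≤ D)
    (hBA : Dominates B A) (hDC : Dominates D C) :
    regRenyiDiv α (Real.sqrt lam) A B + regRenyiDiv α (Real.sqrt lam) C D
      ≤ regRenyiDiv α lam (opTensor A C) (opTensor B D) := by
  have hs := Real.sqrt_nonneg lam
  rw [regRenyiDiv, regRenyiDiv, ← renyiDiv_opTensor hα hα1 hA (add_smul_one_nonneg hB hs) hC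
    (add_smul_one_nonneg hD hs) (hBA.add_smul_one hB hs) (hDC.add_smul_one hD hs)]
  refine renyiDiv_anti hα hα1 (opTensor_nonneg hA.1 hC.1)
    (add_smul_one_nonneg (opTensor_nonneg hB hD) hl) ?_
  rw [opTensor_add_smul_one, ← Complex.ofReal_mul, Real.mul_self_sqrt hl, add_right_comm]
  exact le_add_of_nonneg_right (smul_nonneg_of_real (add_nonneg (opTensor_nonneg hB zero_le_one)
    (opTensor_nonneg zero_le_one hD)) hs)

/-- With μ = λ/3 ≤ 1 and B, D ≤ 1, the cross terms of (B + μ) ⊗ (D + μ) are at most 2μ and μ² ≤ μ,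
so the total is at most B ⊗ D + 3μ. -/
lemma regRenyiDiv_opTensor_le (hα : 1 / 2 ≤ α) (hα1 : α ≠ 1) {lam : ℝ} (hl : 0 ≤ lam)
    (hA : IsPosTraceClass A) (hB : 0 ≤ B) (hC : IsPosTraceClass C) (hD : 0 ≤ D)
    (hBA : Dominates B A) (hDC : Dominates D C) (hB1 : B ≤ 1) (hD1 : D ≤ 1) (hl3 : lam ≤ 3) :
    regRenyiDiv α lam (opTensor A C) (opTensor B D)
      ≤ regRenyiDiv α (lam / 3) A B + regRenyiDiv α (lam / 3) C D := by
  have hs : 0 ≤ lam / 3 := by positivity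
  rw [regRenyiDiv, regRenyiDiv, regRenyiDiv, ← renyiDiv_opTensor hα hα1 hA
    (add_smul_one_nonneg hB hs) hC
    (add_smul_one_nonneg hD hs) (hBA.add_smul_one hB hs) (hDC.add_smul_one hD hs)]
  refine renyiDiv_anti hα hα1 (opTensor_nonneg hA.1 hC.1)
    (opTensor_nonneg (add_smul_one_nonneg hB hs) (add_smul_one_nonneg hD hs)) ?_
  have h1 : 0 ≤ opTensor (1 - B) (1 : K →L[ℂ] K) :=
    opTensor_nonneg (sub_nonneg.2 hB1) zero_le_one
  have h2 : 0 ≤ opTensor (1 : H →L[ℂ] H) (1 - D) :=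
    opTensor_nonneg zero_le_one (sub_nonneg.2 hD1)
  have e1 : opTensor B (1 : K →L[ℂ] K) = 1 - opTensor (1 - B) 1 := by
    rw [eq_sub_iff_add_eq, ← opTensor_add_left, add_sub_cancel, opTensor_one_one]
  have e2 : opTensor (1 : H →L[ℂ] H) D = 1 - opTensor 1 (1 - D) := by
    rw [eq_sub_iff_add_eq, ← opTensor_add_right, add_sub_cancel, opTensor_one_one]
  have h3 : 0 ≤ ((lam / 3 * (1 - lam / 3) : ℝ) : ℂ) • (1 : HTensor H K →L[ℂ] HTensor H K) :=
    smul_one_nonneg (mul_nonneg hs (by linarith))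
  -- The gap is exactly μ ((1 - B) ⊗ 1 + 1 ⊗ (1 - D)) + μ (1 - μ) with μ = λ/3.
  have h4 := add_nonneg (smul_nonneg_of_real (add_nonneg h1 h2) hs) h3
  rw [← sub_nonneg]
  refine h4.trans_eq ?_
  rw [opTensor_add_smul_one, e1, e2]
  push_cast
  module

end Tensor

/-! ### Perturbation estimates and continuity of the divergence. -/

section Continuity

variable {H : Type*} [NormedAddCommGroup H] [InnerProductSpace ℂ H] [CompleteSpace H]
variable {K : Type*} [NormedAddCommGroup K] [InnerProductSpace ℂ K] [CompleteSpace K]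

open Filter

variable {α p : ℝ} {A B E M N : H →L[ℂ] H}

/-! ### Continuity -/

lemma le_abs_self {T : H →L[ℂ] H} (hT : IsSelfAdjoint T) : T ≤ CFC.abs T := by
  rw [← sub_nonneg, CFC.abs_sub_self T hT]
  exact nsmul_nonneg (CFC.negPart_nonneg T) 2

lemma neg_le_abs_self {T : H →L[ℂ] H} (hT : IsSelfAdjoint T) : -T ≤ CFC.abs T := by
  rw [← sub_nonneg, sub_neg_eq_add, CFC.abs_add_self T hT]
  exact nsmul_nonneg (CFC.posPart_nonneg T) 2

lemma smul_rpow_of_nonneg (hA : 0 ≤ A) {c : ℝ} (hc : 0 ≤ c) {r : ℝ} (hr : 0 < r) :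
    ((c : ℂ) • A) ^ r = ((c ^ r : ℝ) : ℂ) • A ^ r := by
  have := eq_rpow_of_semigroup (g := fun q => ((c ^ q : ℝ) : ℂ) • A ^ q)
    (fun q _ => smul_nonneg_of_real CFC.rpow_nonneg (Real.rpow_nonneg hc q))
    (fun q s hq hs => by
      rw [rpow_add_of_pos A hq hs, Real.rpow_add_of_nonneg hc hq.le hs.le, smul_mul_smul_comm,
        Complex.ofReal_mul])
    (by
      refine ContinuousOn.smul (Complex.continuous_ofReal.comp_continuousOn fun q hq => ?_)
        (continuousOn_rpow_exponent A)
      exact (Real.continuousAt_const_rpow' (ne_of_gt hq)).continuousWithinAt) hr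
  rw [this, CFC.rpow_one A hA, Real.rpow_one]

lemma opTrace_rpow_add_le_of_le_one {X Y : H →L[ℂ] H} (hX : 0 ≤ X) (hY : 0 ≤ Y) (hp : 0 < p)
    (hp1 : p ≤ 1) : opTrace ((X + Y) ^ p) ≤ opTrace (X ^ p) + opTrace (Y ^ p) := by
  rcases hp1.lt_or_eq with h | rfl
  · exact opTrace_rpow_add_le hX hY hp h
  · rw [CFC.rpow_one _ (add_nonneg hX hY), CFC.rpow_one X hX, CFC.rpow_one Y hY, opTrace_add hX hY]

lemma opTrace_rpow_smul (hA : 0 ≤ A) {c : ℝ} (hc : 0 ≤ c) (hp : 0 < p) :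
    opTrace (((c : ℂ) • A) ^ p) = ENNReal.ofReal (c ^ p) * opTrace (A ^ p) := by
  rw [smul_rpow_of_nonneg hA hc hp, opTrace_smul (Real.rpow_nonneg hc p)]

lemma sqrt_conj_smul_one (hA : 0 ≤ A) (c : ℂ) :
    CFC.sqrt A * (c • (1 : H →L[ℂ] H)) * CFC.sqrt A = c • A := by
  rw [mul_smul_comm, mul_one, smul_mul_assoc, CFC.sqrt_mul_sqrt_self A hA]

lemma opTrace_rpow_sqrt_conj_le (hA : 0 ≤ A) (hM : 0 ≤ M) (hp : 0 < p) :
    opTrace ((CFC.sqrt A * M * CFC.sqrt A) ^ p) ≤ ENNReal.ofReal (‖M‖ ^ p) * opTrace (A ^ p) := by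
  rw [← opTrace_rpow_smul hA (norm_nonneg M) hp, ← sqrt_conj_smul_one hA]
  exact opTrace_rpow_mono (conj_nonneg hM (sqrt_isSelfAdjoint A))
    (conj_le_conj (le_norm_smul_one hM.isSelfAdjoint) (sqrt_isSelfAdjoint A)) hp

/-- After exchanging the roles of the operators, A + E enters linearly as √M (A + E) √M, and
subadditivity applies. -/
lemma opTrace_rpow_sqrt_conj_add_le (hA : 0 ≤ A) (hE : 0 ≤ E) (hM : 0 ≤ M) (hp : 0 < p)
    (hp1 : p ≤ 1) : opTrace ((CFC.sqrt (A + E) * M * CFC.sqrt (A + E)) ^ p)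
      ≤ opTrace ((CFC.sqrt A * M * CFC.sqrt A) ^ p)
        + opTrace ((CFC.sqrt E * M * CFC.sqrt E) ^ p) := by
  rw [opTrace_rpow_conj_comm (add_nonneg hA hE) hM hp, opTrace_rpow_conj_comm hA hM hp,
    opTrace_rpow_conj_comm hE hM hp, mul_add, add_mul]
  exact opTrace_rpow_add_le_of_le_one (conj_nonneg hA (sqrt_isSelfAdjoint M))
    (conj_nonneg hE (sqrt_isSelfAdjoint M)) hp hp1

lemma opTrace_rpow_sqrt_conj_mono {A' : H →L[ℂ] H} (hA : 0 ≤ A) (h : A ≤ A') (hM : 0 ≤ M)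
    (hp : 0 < p) : opTrace ((CFC.sqrt A * M * CFC.sqrt A) ^ p)
      ≤ opTrace ((CFC.sqrt A' * M * CFC.sqrt A') ^ p) := by
  rw [opTrace_rpow_conj_comm hA hM hp, opTrace_rpow_conj_comm (hA.trans h) hM hp]
  exact opTrace_rpow_mono (conj_nonneg hA (sqrt_isSelfAdjoint M))
    (conj_le_conj h (sqrt_isSelfAdjoint M)) hp

/-- M ≤ N + ‖M - N‖ · 1, combined with monotonicity and subadditivity of the trace of the p-th
power. -/
lemma opTrace_rpow_sqrt_conj_le_add (hA : 0 ≤ A) (hM : 0 ≤ M) (hN : 0 ≤ N) (hp : 0 < p)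
    (hp1 : p ≤ 1) : opTrace ((CFC.sqrt A * M * CFC.sqrt A) ^ p)
      ≤ opTrace ((CFC.sqrt A * N * CFC.sqrt A) ^ p)
        + ENNReal.ofReal (‖M - N‖ ^ p) * opTrace (A ^ p) := by
  have hAs := sqrt_isSelfAdjoint A
  have h : M ≤ N + ((‖M - N‖ : ℝ) : ℂ) • (1 : H →L[ℂ] H) :=
    sub_le_iff_le_add'.1 (le_norm_smul_one (hM.isSelfAdjoint.sub hN.isSelfAdjoint))
  refine (opTrace_rpow_mono (conj_nonneg hM hAs) (conj_le_conj h hAs) hp).trans ?_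
  rw [mul_add, add_mul, sqrt_conj_smul_one hA, ← opTrace_rpow_smul hA (norm_nonneg _) hp]
  exact opTrace_rpow_add_le_of_le_one (conj_nonneg hN hAs)
    (smul_nonneg_of_real hA (norm_nonneg _)) hp hp1

lemma opTrace_rpow_sqrt_conj_le_of_le {A' : H →L[ℂ] H} (hA : 0 ≤ A) (hA' : 0 ≤ A') (hE : 0 ≤ E)
    (h : A ≤ A' + E) (hM : 0 ≤ M) (hp : 0 < p) (hp1 : p ≤ 1) :
    opTrace ((CFC.sqrt A * M * CFC.sqrt A) ^ p)
      ≤ opTrace ((CFC.sqrt A' * M * CFC.sqrt A') ^ p)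
        + ENNReal.ofReal (‖M‖ ^ p) * opTrace (E ^ p) :=
  (opTrace_rpow_sqrt_conj_mono hA h hM hp).trans <|
    (opTrace_rpow_sqrt_conj_add_le hA' hE hM hp hp1).trans <|
      add_le_add_right (opTrace_rpow_sqrt_conj_le hE hM hp) _

lemma tendsto_of_le_add {u d : ℕ → ℝ≥0∞} {a : ℝ≥0∞} (ha : a ≠ ∞) (hd : Tendsto d atTop (𝓝 0))
    (h1 : ∀ n, u n ≤ a + d n) (h2 : ∀ n, a ≤ u n + d n) : Tendsto u atTop (𝓝 a) := by
  have hl : Tendsto (fun n => a - d n) atTop (𝓝 (a - 0)) :=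
    ENNReal.Tendsto.sub tendsto_const_nhds hd (Or.inl ha)
  have hr : Tendsto (fun n => a + d n) atTop (𝓝 (a + 0)) := tendsto_const_nhds.add hd
  rw [tsub_zero] at hl
  rw [add_zero] at hr
  exact tendsto_of_tendsto_of_tendsto_of_le_of_le hl hr
    (fun n => tsub_le_iff_right.2 (h2 n)) h1

/-- Joint continuity of `(A, M) ↦ tr ((√A M √A) ^ p)`, in the Schatten `p`-quasinorm for `A` and
in the operator norm for `M`. -/
lemma tendsto_opTrace_rpow_sqrt_conj (hp : 0 < p) (hp1 : p ≤ 1) (hA : 0 ≤ A) (hM : 0 ≤ M)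
    (hfin : opTrace (A ^ p) ≠ ∞) {An Mn : ℕ → H →L[ℂ] H} (hAn : ∀ n, 0 ≤ An n)
    (hMn : ∀ n, 0 ≤ Mn n) (hAlim : Tendsto (fun n => schattenPow p (An n - A)) atTop (𝓝 0))
    (hMlim : Tendsto Mn atTop (𝓝 M)) :
    Tendsto (fun n => opTrace ((CFC.sqrt (An n) * Mn n * CFC.sqrt (An n)) ^ p)) atTop
      (𝓝 (opTrace ((CFC.sqrt A * M * CFC.sqrt A) ^ p))) := by
  have hsa : ∀ n, IsSelfAdjoint (An n - A) := fun n => (hAn n).isSelfAdjoint.sub hA.isSelfAdjoint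
  have hE : ∀ n, 0 ≤ CFC.abs (An n - A) := fun n => CFC.abs_nonneg _
  have h1 : ∀ n, An n ≤ A + CFC.abs (An n - A) := fun n =>
    sub_le_iff_le_add'.1 (le_abs_self (hsa n))
  have h2 : ∀ n, A ≤ An n + CFC.abs (An n - A) := fun n => by
    have := neg_le_abs_self (hsa n)
    rwa [neg_sub, sub_le_iff_le_add'] at this
  -- This one error term, from the norm change of M and from |Aₙ - A|, bounds the difference of the
  -- traces in both directions.
  have hd : Tendsto (fun n => ENNReal.ofReal (‖Mn n - M‖ ^ p) * opTrace (A ^ p)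
      + ENNReal.ofReal (‖Mn n‖ ^ p) * schattenPow p (An n - A)) atTop (𝓝 0) := by
    have e1 : Tendsto (fun n => ENNReal.ofReal (‖Mn n - M‖ ^ p)) atTop (𝓝 0) := by
      have := ENNReal.tendsto_ofReal
        ((tendsto_iff_norm_sub_tendsto_zero.1 hMlim).rpow_const (Or.inr hp.le))
      rwa [Real.zero_rpow hp.ne', ENNReal.ofReal_zero] at this
    have e2 := ENNReal.tendsto_ofReal (hMlim.norm.rpow_const (p := p) (Or.inr hp.le))
    have e3 := (ENNReal.Tendsto.mul_const e1 (Or.inr hfin)).add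
      (ENNReal.Tendsto.mul e2 (Or.inr ENNReal.zero_ne_top) hAlim (Or.inr ENNReal.ofReal_ne_top))
    simpa using e3
  refine tendsto_of_le_add ?_ hd (fun n => ?_) fun n => ?_
  · exact ne_top_of_le_ne_top (ENNReal.mul_ne_top ENNReal.ofReal_ne_top hfin)
      (opTrace_rpow_sqrt_conj_le hA hM hp)
  · refine (opTrace_rpow_sqrt_conj_le_of_le (hAn n) hA (hE n) (h1 n) (hMn n) hp hp1).trans ?_
    rw [← add_assoc]
    exact add_le_add_left (opTrace_rpow_sqrt_conj_le_add hA (hMn n) hM hp hp1) _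
  · refine (opTrace_rpow_sqrt_conj_le_add hA hM (hMn n) hp hp1).trans ?_
    rw [norm_sub_rev M, add_comm (_ * _) (_ * _), ← add_assoc]
    exact add_le_add_left (opTrace_rpow_sqrt_conj_le_of_le hA (hAn n) (hE n) (h2 n) (hMn n) hp hp1) _

/-- A = A ^ (p/2) A ^ (1-p) A ^ (p/2), with the middle factor bounded by its norm. -/
lemma opTrace_le_mul_opTrace_rpow (hA : 0 ≤ A) (hp : 0 < p) (hp1 : p < 1) :
    opTrace A ≤ ENNReal.ofReal ‖A ^ (1 - p)‖ * opTrace (A ^ p) := by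
  have h := opTrace_sandwich_le (A := A ^ p) CFC.rpow_nonneg (norm_nonneg (A ^ (1 - p)))
    (le_norm_smul_one (rpow_isSelfAdjoint A _))
  have e : CFC.sqrt (A ^ p) * A ^ (1 - p) * CFC.sqrt (A ^ p) = A := by
    rw [sqrt_rpow_of_pos A hp, ← rpow_add_of_pos A (by linarith) (by linarith),
      ← rpow_add_of_pos A (by linarith) (by linarith)]
    conv_rhs => rw [← CFC.rpow_one A hA]
    congr 1
    ring
  rwa [e] at h

lemma opTrace_ne_top_of_rpow (hA : 0 ≤ A) (hp : 0 < p) (hp1 : p ≤ 1) (h : opTrace (A ^ p) ≠ ∞) :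
    opTrace A ≠ ∞ := by
  rcases hp1.lt_or_eq with hp1 | rfl
  · exact ne_top_of_le_ne_top (ENNReal.mul_ne_top ENNReal.ofReal_ne_top h)
      (opTrace_le_mul_opTrace_rpow hA hp hp1)
  · rwa [CFC.rpow_one A hA] at h

/-- tr A ^ p ≤ 1 forces ‖A‖ ≤ 1, so the factor ‖A ^ (1-p)‖ is at most 1. Convergence in the
p-quasinorm therefore implies trace-norm convergence. -/
lemma opTrace_le_opTrace_rpow (hA : 0 ≤ A) (hp : 0 < p) (hp1 : p ≤ 1) (h : opTrace (A ^ p) ≤ 1) :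
    opTrace A ≤ opTrace (A ^ p) := by
  rcases hp1.lt_or_eq with hp1 | rfl
  · have h1 : ‖A‖ ^ p ≤ 1 := by
      rw [← CFC.norm_rpow A hp hA]
      have := (ofReal_norm_le_opTrace (CFC.rpow_nonneg (a := A) (y := p))).trans h
      rwa [ENNReal.ofReal_le_one] at this
    have h2 : ‖A‖ ≤ 1 := by
      by_contra! hlt
      exact absurd h1 (not_le.2 (Real.one_lt_rpow hlt hp))
    have h3 : ‖A ^ (1 - p)‖ ≤ 1 := by
      rw [CFC.norm_rpow A (by linarith) hA]
      exact Real.rpow_le_one (norm_nonneg A) h2 (by linarith)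
    refine (opTrace_le_mul_opTrace_rpow hA hp hp1).trans (mul_le_of_le_one_left' ?_)
    rwa [ENNReal.ofReal_le_one]
  · rw [CFC.rpow_one A hA]

lemma schattenPow_one_eq (T : H →L[ℂ] H) : schattenPow 1 T = opTrace (CFC.abs T) := by
  rw [schattenPow, CFC.rpow_one _ (CFC.abs_nonneg T)]

lemma schattenPow_of_nonneg (hA : 0 ≤ A) : schattenPow p A = opTrace (A ^ p) := by
  rw [schattenPow, CFC.abs_of_nonneg A hA]

lemma tendsto_schattenPow_one (hp : 0 < p) (hp1 : p ≤ 1) {T : ℕ → H →L[ℂ] H}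
    (h : Tendsto (fun n => schattenPow p (T n)) atTop (𝓝 0)) :
    Tendsto (fun n => schattenPow 1 (T n)) atTop (𝓝 0) := by
  refine tendsto_of_tendsto_of_tendsto_of_le_of_le' tendsto_const_nhds h
    (Eventually.of_forall fun n => zero_le) ?_
  filter_upwards [h.eventually_le_const (zero_lt_one)] with n hn
  rw [schattenPow_one_eq]
  exact opTrace_le_opTrace_rpow (CFC.abs_nonneg _) hp hp1 hn

lemma tendsto_of_schattenPow_one {An : ℕ → H →L[ℂ] H}
    (h : Tendsto (fun n => schattenPow 1 (An n - A)) atTop (𝓝 0)) : Tendsto An atTop (𝓝 A) := by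
  rw [tendsto_iff_norm_sub_tendsto_zero]
  have h1 : Tendsto (fun n => ENNReal.ofReal ‖An n - A‖) atTop (𝓝 0) := by
    refine tendsto_of_tendsto_of_tendsto_of_le_of_le tendsto_const_nhds h
      (fun n => zero_le) fun n => ?_
    change _ ≤ schattenPow 1 (An n - A)
    rw [schattenPow_one_eq, ← CFC.norm_abs]
    exact ofReal_norm_le_opTrace (CFC.abs_nonneg _)
  have h2 := (ENNReal.tendsto_toReal ENNReal.zero_ne_top).comp h1
  simpa [Function.comp_def, ENNReal.toReal_ofReal (norm_nonneg _)] using h2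

lemma tendsto_opTrace (hA : 0 ≤ A) (hfin : opTrace A ≠ ∞) {An : ℕ → H →L[ℂ] H}
    (hAn : ∀ n, 0 ≤ An n) (h : Tendsto (fun n => schattenPow 1 (An n - A)) atTop (𝓝 0)) :
    Tendsto (fun n => opTrace (An n)) atTop (𝓝 (opTrace A)) := by
  have := tendsto_opTrace_rpow_sqrt_conj (M := 1) (Mn := fun _ => 1) one_pos le_rfl hA zero_le_one
    (by rwa [CFC.rpow_one A hA]) hAn (fun _ => zero_le_one) h tendsto_const_nhds
  have e : ∀ T : H →L[ℂ] H, 0 ≤ T → (CFC.sqrt T * 1 * CFC.sqrt T) ^ (1 : ℝ) = T := fun T hT => by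
    rw [mul_one, CFC.sqrt_mul_sqrt_self T hT, CFC.rpow_one T hT]
  simpa only [e _ hA, e _ (hAn _)] using this

lemma tendsto_rpow {r : ℝ} (hr : 0 < r) (hB : 0 ≤ B) {Bn : ℕ → H →L[ℂ] H} (hBn : ∀ n, 0 ≤ Bn n)
    (h : Tendsto Bn atTop (𝓝 B)) : Tendsto (fun n => Bn n ^ r) atTop (𝓝 (B ^ r)) := by
  lift r to NNReal using hr.le
  have hr' : 0 < r := by exact_mod_cast hr
  have h1 := (CFC.continuousOn_nnrpow r).continuousWithinAt (x := B) hB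
  have h2 := h1.tendsto.comp (tendsto_nhdsWithin_iff.2 ⟨h, Eventually.of_forall hBn⟩)
  simpa only [Function.comp_def, CFC.nnrpow_eq_rpow hr'] using h2

lemma tendsto_rpow_of_isUnit (r : ℝ) (hB : 0 ≤ B) (hu : IsUnit B) {Bn : ℕ → H →L[ℂ] H}
    (hBn : ∀ n, 0 ≤ Bn n) (hun : ∀ n, IsUnit (Bn n)) (h : Tendsto Bn atTop (𝓝 B)) :
    Tendsto (fun n => Bn n ^ r) atTop (𝓝 (B ^ r)) := by
  have h1 := (CFC.continuousOn_rpow r).continuousWithinAt (x := B) (hu.isStrictlyPositive hB)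
  exact h1.tendsto.comp (tendsto_nhdsWithin_iff.2
    ⟨h, Eventually.of_forall fun n => (hun n).isStrictlyPositive (hBn n)⟩)

lemma rpow_half_conj_self {X : H →L[ℂ] H} (hX : 0 ≤ X) (hα : 1 < α) :
    X ^ ((α - 1) / 2) * X * X ^ ((α - 1) / 2) = X ^ α := by
  have hr : 0 < (α - 1) / 2 := by linarith
  have h : X ^ ((α - 1) / 2) * X = X ^ ((α - 1) / 2 + 1) := by
    rw [rpow_add_of_pos X hr one_pos, CFC.rpow_one X hX]
  rw [h, ← rpow_add_of_pos X (by linarith) hr]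
  congr 1
  ring

lemma opTrace_conj_conj_comm {P R : H →L[ℂ] H} (hA : 0 ≤ A) (hP : IsSelfAdjoint P)
    (hR : IsSelfAdjoint R) :
    opTrace (R * (P * A * P) * R) = opTrace (CFC.sqrt A * (P * (R * R) * P) * CFC.sqrt A) := by
  have h := opTrace_star_mul_self (CFC.sqrt A * P * R)
  rw [star_mul, star_mul, (sqrt_isSelfAdjoint A).star_eq, hP.star_eq, hR.star_eq] at h
  have e1 : R * (P * A * P) * R = R * (P * CFC.sqrt A) * (CFC.sqrt A * P * R) := by
    conv_lhs => rw [← CFC.sqrt_mul_sqrt_self A hA]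
    simp only [mul_assoc]
  have e2 : CFC.sqrt A * (P * (R * R) * P) * CFC.sqrt A
      = CFC.sqrt A * P * R * (R * (P * CFC.sqrt A)) := by
    simp only [mul_assoc]
  rw [e1, e2, h]

/-- Subadditivity is not available for powers above 1. With X = P A P, write X ^ α = X ^ ((α-1)/2) X
X ^ ((α-1)/2) and cycle: A then enters through the trace itself, with a bounded middle operator. The
exponent 1 is kept to match the case p = 1 of the joint continuity. -/
lemma opTrace_rpow_conj_eq {P : H →L[ℂ] H} (hA : 0 ≤ A) (hP : IsSelfAdjoint P) (hα : 1 < α) :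
    opTrace ((P * A * P) ^ α)
      = opTrace ((CFC.sqrt A * (P * (P * A * P) ^ (α - 1) * P) * CFC.sqrt A) ^ (1 : ℝ)) := by
  have h1 : 0 ≤ CFC.sqrt A * (P * (P * A * P) ^ (α - 1) * P) * CFC.sqrt A :=
    conj_nonneg (conj_nonneg CFC.rpow_nonneg hP) (sqrt_isSelfAdjoint A)
  rw [CFC.rpow_one _ h1, ← rpow_half_conj_self (conj_nonneg hA hP) hα,
    ← rpow_half_mul_self (P * A * P) (sub_pos.2 hα)]
  exact opTrace_conj_conj_comm hA hP (rpow_isSelfAdjoint _ _)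

lemma tendsto_sandwichTrace_of_lt_one (hα : 1 / 2 ≤ α) (hα1 : α < 1) (hA : 0 ≤ A) (hB : 0 ≤ B)
    (hfin : opTrace (A ^ α) ≠ ∞) {An Bn : ℕ → H →L[ℂ] H} (hAn : ∀ n, 0 ≤ An n)
    (hBn : ∀ n, 0 ≤ Bn n) (hAlim : Tendsto (fun n => schattenPow α (An n - A)) atTop (𝓝 0))
    (hBlim : Tendsto Bn atTop (𝓝 B)) :
    Tendsto (fun n => sandwichTrace α (An n) (Bn n)) atTop (𝓝 (sandwichTrace α A B)) := by
  have hs := exponent_pos_of_lt_one hα hα1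
  have := tendsto_opTrace_rpow_sqrt_conj (by linarith) hα1.le hA CFC.rpow_nonneg hfin hAn
    (fun _ => CFC.rpow_nonneg) hAlim
    (tendsto_rpow (r := 2 * ((1 - α) / (2 * α))) (by linarith) hB hBn hBlim)
  simpa only [← sandwichTrace_of_lt_one_symm hα hα1 hA,
    ← sandwichTrace_of_lt_one_symm hα hα1 (hAn _)] using this

/-- Trace-norm convergence of Aₙ gives norm convergence, so the middle operators Pₙ Xₙ ^ (α-1) Pₙ,
with Pₙ the negative power of Bₙ and Xₙ = Pₙ Aₙ Pₙ, converge in norm; invertibility is needed for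
Pₙ. -/
lemma tendsto_sandwichTrace_of_one_lt (hα : 1 < α) (hA : 0 ≤ A) (hB : 0 ≤ B) (hu : IsUnit B)
    (hfin : opTrace A ≠ ∞) {An Bn : ℕ → H →L[ℂ] H} (hAn : ∀ n, 0 ≤ An n)
    (hBn : ∀ n, 0 ≤ Bn n) (hun : ∀ n, IsUnit (Bn n))
    (hAlim : Tendsto (fun n => schattenPow 1 (An n - A)) atTop (𝓝 0))
    (hBlim : Tendsto Bn atTop (𝓝 B)) :
    Tendsto (fun n => sandwichTrace α (An n) (Bn n)) atTop (𝓝 (sandwichTrace α A B)) := by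
  set r := (1 - α) / (2 * α) with hr
  have hP := tendsto_rpow_of_isUnit r hB hu hBn hun hBlim
  have hX := (hP.mul (tendsto_of_schattenPow_one hAlim)).mul hP
  have hXr := tendsto_rpow (r := α - 1) (by linarith) (conj_nonneg hA (rpow_isSelfAdjoint B r))
    (fun n => conj_nonneg (hAn n) (rpow_isSelfAdjoint (Bn n) r)) hX
  have := tendsto_opTrace_rpow_sqrt_conj one_pos le_rfl hA
    (conj_nonneg CFC.rpow_nonneg (rpow_isSelfAdjoint B r)) (by rwa [CFC.rpow_one A hA]) hAn
    (fun n => conj_nonneg CFC.rpow_nonneg (rpow_isSelfAdjoint (Bn n) r)) hAlim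
    ((hP.mul hXr).mul hP)
  simp only [← opTrace_rpow_conj_eq hA (rpow_isSelfAdjoint B r) hα,
    ← opTrace_rpow_conj_eq (hAn _) (rpow_isSelfAdjoint (Bn _) r) hα] at this
  simpa only [sandwichTrace_of_isUnit hA hB hu,
    sandwichTrace_of_isUnit (hAn _) (hBn _) (hun _)] using this

lemma sandwichTrace_ne_top_of_lt_one (hα : 1 / 2 ≤ α) (hα1 : α < 1) (hA : 0 ≤ A)
    (hfin : opTrace (A ^ α) ≠ ∞) : sandwichTrace α A B ≠ ∞ := by
  rw [sandwichTrace_of_lt_one_symm hα hα1 hA]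
  exact ne_top_of_le_ne_top (ENNReal.mul_ne_top ENNReal.ofReal_ne_top hfin)
    (opTrace_rpow_sqrt_conj_le hA CFC.rpow_nonneg (by linarith))

lemma sandwichTrace_ne_top_of_one_lt (hα : 1 < α) (hA : 0 ≤ A) (hB : 0 ≤ B) (hu : IsUnit B)
    (hfin : opTrace A ≠ ∞) : sandwichTrace α A B ≠ ∞ := by
  rw [sandwichTrace_of_isUnit hA hB hu, opTrace_rpow_conj_eq hA (rpow_isSelfAdjoint B _) hα]
  refine ne_top_of_le_ne_top (ENNReal.mul_ne_top ENNReal.ofReal_ne_top ?_)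
    (opTrace_rpow_sqrt_conj_le hA (conj_nonneg CFC.rpow_nonneg (rpow_isSelfAdjoint B _)) one_pos)
  rwa [CFC.rpow_one A hA]

lemma coe_mul_log_ne {c : ℝ} {x : ℝ≥0∞} (hx : x ≠ 0) (hx' : x ≠ ∞) :
    (c : EReal) * ENNReal.log x ≠ ⊥ ∧ (c : EReal) * ENNReal.log x ≠ ⊤ := by
  have h1 : ENNReal.log x ≠ ⊥ := by simpa using hx
  have h2 : ENNReal.log x ≠ ⊤ := by simpa using hx'
  lift ENNReal.log x to ℝ using ⟨h2, h1⟩ with y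
  rw [← EReal.coe_mul]
  exact ⟨EReal.coe_ne_bot _, EReal.coe_ne_top _⟩

lemma tendsto_coe_mul_log (c : ℝ) {u : ℕ → ℝ≥0∞} {x : ℝ≥0∞} (hx : x ≠ 0) (hx' : x ≠ ∞)
    (h : Tendsto u atTop (𝓝 x)) :
    Tendsto (fun n => (c : EReal) * ENNReal.log (u n)) atTop (𝓝 (c * ENNReal.log x)) := by
  have h1 : ENNReal.log x ≠ ⊥ := by simpa using hx
  have h2 : ENNReal.log x ≠ ⊤ := by simpa using hx'
  have h3 : ContinuousAt (fun p : EReal × EReal => p.1 * p.2) ((c : EReal), ENNReal.log x) :=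
    EReal.continuousAt_mul (Or.inr h1) (Or.inr h2) (Or.inl (EReal.coe_ne_bot c))
      (Or.inl (EReal.coe_ne_top c))
  exact h3.tendsto.comp
    (tendsto_const_nhds.prodMk_nhds ((ENNReal.continuous_log.tendsto x).comp h))

lemma isUnit_add_smul_one (hB : 0 ≤ B) {lam : ℝ} (hl : 0 ≤ lam) (h : 0 < lam ∨ IsUnit B) :
    IsUnit (B + (lam : ℂ) • (1 : H →L[ℂ] H)) := by
  rcases h with h | h
  · exact CStarAlgebra.isUnit_of_le _ (le_add_of_nonneg_left hB)
      ((isUnit_smul_one h).isStrictlyPositive (smul_one_nonneg hl))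
  · exact CStarAlgebra.isUnit_of_le _ (le_add_of_nonneg_right (smul_one_nonneg hl))
      (h.isStrictlyPositive hB)

theorem regRenyiDiv_continuous (hα : 1 / 2 ≤ α) (hα1 : α ≠ 1) {lam : ℝ} (hl : 0 ≤ lam)
    (hA : 0 ≤ A) (hB : 0 ≤ B) (hA0 : A ≠ 0) (hfin : schattenPow (min α 1) A < ∞)
    (hBA : Dominates (B + (lam : ℂ) • (1 : H →L[ℂ] H)) A) (h : 0 < lam ∨ α < 1 ∨ IsUnit B) :
    regRenyiDiv α lam A B ≠ ⊥ ∧ regRenyiDiv α lam A B ≠ ⊤ ∧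
      ∀ (An Bn : ℕ → H →L[ℂ] H), (∀ n, 0 ≤ An n) → (∀ n, 0 ≤ Bn n) →
        Tendsto (fun n => schattenPow (min α 1) (An n - A)) atTop (𝓝 0) →
        Tendsto Bn atTop (𝓝 B) →
        Tendsto (fun n => regRenyiDiv α lam (An n) (Bn n)) atTop (𝓝 (regRenyiDiv α lam A B)) := by
  have hp : 0 < min α 1 := lt_min (by linarith) one_pos
  have hp1 : min α 1 ≤ 1 := min_le_right _ _
  rw [schattenPow_of_nonneg hA] at hfin
  have hBl := add_smul_one_nonneg hB hl
  have htr : opTrace A ≠ ∞ := opTrace_ne_top_of_rpow hA hp hp1 hfin.ne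
  have htr0 : opTrace A ≠ 0 := IsPosTraceClass.opTrace_ne_zero ⟨hA, hA0, htr.lt_top⟩
  have hQ0 := sandwichTrace_ne_zero hα hα1 hA hA0 hBl hBA
  have hQ : sandwichTrace α A (B + (lam : ℂ) • (1 : H →L[ℂ] H)) ≠ ∞ := by
    rcases lt_or_gt_of_ne hα1 with h1 | h1
    · rw [min_eq_left h1.le] at hfin
      exact sandwichTrace_ne_top_of_lt_one hα h1 hA hfin.ne
    · exact sandwichTrace_ne_top_of_one_lt h1 hA hBl
        (isUnit_add_smul_one hB hl (h.imp_right (Or.resolve_left · h1.not_gt))) htr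
  have hq0 : sandwichTrace α A (B + (lam : ℂ) • (1 : H →L[ℂ] H)) / opTrace A ≠ 0 :=
    (ENNReal.div_pos hQ0 htr).ne'
  have hq := ENNReal.div_ne_top hQ htr0
  refine ⟨(coe_mul_log_ne hq0 hq).1, (coe_mul_log_ne hq0 hq).2, fun An Bn hAn hBn hAl hBl' => ?_⟩
  refine tendsto_coe_mul_log _ hq0 hq (ENNReal.Tendsto.div ?_ (Or.inl hQ0)
    (tendsto_opTrace hA htr hAn (tendsto_schattenPow_one hp hp1 hAl)) (Or.inl htr))
  have hBlim : Tendsto (fun n => Bn n + (lam : ℂ) • (1 : H →L[ℂ] H)) atTop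
      (𝓝 (B + (lam : ℂ) • (1 : H →L[ℂ] H))) := hBl'.add tendsto_const_nhds
  rcases lt_or_gt_of_ne hα1 with h1 | h1
  · rw [min_eq_left h1.le] at hfin hAl
    exact tendsto_sandwichTrace_of_lt_one hα h1 hA hBl hfin.ne hAn
      (fun n => add_smul_one_nonneg (hBn n) hl) hAl hBlim
  · rw [min_eq_right h1.le] at hAl
    have hu := isUnit_add_smul_one hB hl (h.imp_right (Or.resolve_left · h1.not_gt))
    -- Invertible operators form an open set, so the regularized Bₙ are invertible from some index m
    -- on; dropping the first m terms does not affect the limit.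
    obtain ⟨m, hm⟩ := eventually_atTop.1 (hBlim.eventually (Units.isOpen.mem_nhds hu))
    rw [← tendsto_add_atTop_iff_nat m]
    exact tendsto_sandwichTrace_of_one_lt h1 hA hBl hu htr (fun n => hAn (n + m))
      (fun n => add_smul_one_nonneg (hBn (n + m)) hl) (fun n => hm _ (Nat.le_add_left m n))
      ((tendsto_add_atTop_iff_nat m).2 hAl) ((tendsto_add_atTop_iff_nat m).2 hBlim)

end Continuity

end QRenyi

end

theorem mainTheorem12
    {H : Type*} [NormedAddCommGroup H] [InnerProductSpace ℂ H] [CompleteSpace H]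
    {K : Type*} [NormedAddCommGroup K] [InnerProductSpace ℂ K] [CompleteSpace K]
    (α : ℝ) (hα : 1 / 2 ≤ α) (hα1 : α ≠ 1) :
    -- Continuity
    (∀ (lam : ℝ) (A B : H →L[ℂ] H), 0 ≤ lam → 0 ≤ A → 0 ≤ B → A ≠ 0 →
      QRenyi.schattenPow (min α 1) A < ⊤ →
      QRenyi.Dominates (B + (lam : ℂ) • (1 : H →L[ℂ] H)) A →
      (0 < lam ∨ α < 1 ∨ IsUnit B) →
      QRenyi.regRenyiDiv α lam A B ≠ ⊥ ∧ QRenyi.regRenyiDiv α lam A B ≠ ⊤ ∧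
      ∀ (An Bn : ℕ → H →L[ℂ] H), (∀ n, 0 ≤ An n) → (∀ n, 0 ≤ Bn n) →
        Filter.Tendsto (fun n => QRenyi.schattenPow (min α 1) (An n - A)) Filter.atTop (𝓝 0) →
        Filter.Tendsto Bn Filter.atTop (𝓝 B) →
        Filter.Tendsto (fun n => QRenyi.regRenyiDiv α lam (An n) (Bn n)) Filter.atTop
          (𝓝 (QRenyi.regRenyiDiv α lam A B))) ∧
    -- Unitary invariance
    (∀ (lam : ℝ) (A B U : H →L[ℂ] H), 0 ≤ lam → QRenyi.IsPosTraceClass A → 0 ≤ B →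
      U ∈ unitary (H →L[ℂ] H) →
      QRenyi.regRenyiDiv α lam A B
        = QRenyi.regRenyiDiv α lam (U * A * star U) (U * B * star U)) ∧
    -- Normalization
    (∀ lam : ℝ, 0 ≤ lam →
      QRenyi.regRenyiDiv α lam (1 : ℂ →L[ℂ] ℂ) ((1 / 2 : ℂ) • (1 : ℂ →L[ℂ] ℂ))
        = ((-Real.log (1 / 2 + lam) : ℝ) : EReal)) ∧
    -- Order
    (∀ A B : H →L[ℂ] H, QRenyi.IsPosTraceClass A → 0 ≤ B → B ≤ A →
      QRenyi.regRenyiDiv α 0 A B = QRenyi.renyiDiv α A B ∧ 0 ≤ QRenyi.renyiDiv α A B) ∧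
    (∀ (lam : ℝ) (A B : H →L[ℂ] H), 0 ≤ lam → QRenyi.IsPosTraceClass A → 0 ≤ B → A ≤ B →
      QRenyi.regRenyiDiv α lam A B ≤ 0) ∧
    -- Additivity
    (∀ (lam : ℝ) (A B : H →L[ℂ] H) (C D : K →L[ℂ] K), 0 ≤ lam →
      QRenyi.IsPosTraceClass A → 0 ≤ B → QRenyi.IsPosTraceClass C → 0 ≤ D →
      QRenyi.Dominates B A → QRenyi.Dominates D C →
      QRenyi.regRenyiDiv α (Real.sqrt lam) A B + QRenyi.regRenyiDiv α (Real.sqrt lam) C D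
          ≤ QRenyi.regRenyiDiv α lam (QRenyi.opTensor A C) (QRenyi.opTensor B D) ∧
      (B ≤ 1 → D ≤ 1 → lam ≤ 3 →
        QRenyi.regRenyiDiv α lam (QRenyi.opTensor A C) (QRenyi.opTensor B D)
          ≤ QRenyi.regRenyiDiv α (lam / 3) A B + QRenyi.regRenyiDiv α (lam / 3) C D)) ∧
    -- Mean
    (∀ (lam : ℝ) (A B : H →L[ℂ] H) (C D : K →L[ℂ] K), 0 ≤ lam →
      QRenyi.IsPosTraceClass A → 0 ≤ B → QRenyi.IsPosTraceClass C → 0 ≤ D →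
      QRenyi.Dominates B A → QRenyi.Dominates D C →
      QRenyi.opTrace A + QRenyi.opTrace C ≤ 1 → QRenyi.opTrace B + QRenyi.opTrace D ≤ 1 →
      QRenyi.regRenyiDiv α lam (QRenyi.opSum A C) (QRenyi.opSum B D)
        = QRenyi.expMeanInv α
          (QRenyi.opTrace A / (QRenyi.opTrace A + QRenyi.opTrace C)
              * QRenyi.expMean α (QRenyi.regRenyiDiv α lam A B)
            + QRenyi.opTrace C / (QRenyi.opTrace A + QRenyi.opTrace C)
              * QRenyi.expMean α (QRenyi.regRenyiDiv α lam C D))) := by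
  refine ⟨fun lam A B hl hA hB hA0 hfin hBA h =>
      QRenyi.regRenyiDiv_continuous hα hα1 hl hA hB hA0 hfin hBA h,
    fun lam A B U hl hA hB hU => QRenyi.regRenyiDiv_unitary hα hα1 hU hA.1 hB hl,
    fun lam hl => QRenyi.regRenyiDiv_one_half hα hα1 hl,
    fun A B hA hB h => ⟨QRenyi.regRenyiDiv_zero, ?_⟩,
    fun lam A B hl hA hB h => ?_,
    fun lam A B C D hl hA hB hC hD hBA hDC =>
      ⟨QRenyi.add_le_regRenyiDiv_opTensor hα hα1 hl hA hB hC hD hBA hDC, fun hB1 hD1 hl3 =>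
        QRenyi.regRenyiDiv_opTensor_le hα hα1 hl hA hB hC hD hBA hDC hB1 hD1 hl3⟩,
    fun lam A B C D hl hA hB hC hD _ _ _ _ =>
      QRenyi.regRenyiDiv_opSum hα hα1 hl hA hB hC hD⟩
  -- 0 = D(A‖A) ≤ D(A‖B); the other case uses A ≤ B ≤ B + λ.
  · exact (QRenyi.renyiDiv_self hα hα1 hA).ge.trans
      (QRenyi.renyiDiv_anti hα hα1 hA.1 hB h)
  · exact (QRenyi.renyiDiv_anti hα hα1 hA.1 hA.1
      (h.trans (le_add_of_nonneg_right (QRenyi.smul_one_nonneg hl)))).trans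
      (QRenyi.renyiDiv_self hα hα1 hA).le
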